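/- Let $\mathcal X$ be a finite set with $|\mathcal X|\ge 2$, let $p_X$ be a computable probability distribution on $\mathcal X$ with $p_X(x)>0$ for all $x$, let $d:\mathcal X\times\mathcal X\to[0,\infty)$, and let $\{B_n\}_{n\ge1}$ be positive integers with $\log(B_n)/n\to0$. Logarithms are in base 2, $[t]=\{1,\dots,\lfloor t\rfloor\}$, and $d$ is extended to words, and to batches of words, by averaging over letters and over the items of the batch. A real function $f$ on a set of finite objects is *lower semi-computable* if there is a computable rational-valued $\varphi(x,k)$, nondecreasing in $k$, with $\varphi(x,k)\to f(x)$ as $k\to\infty$ for all $x$; $f$ is *computable* if $f$ and $-f$ are lower semi-computable. Elements of $\mathcal X$ and words over $\mathcal X$ are coded through any fixed injection of $\mathcal X$ into the set of binary words of some fixed length. A *$p_X^{\otimes *}$-critic* is a function $\delta:\bigcup_{n\ge1}\mathcal X^n\to\mathbb R$ with $\sum_{x\in\mathcal X^n}p_X^{\otimes n}(x)2^{\delta(x)}\le1$ for every $n\ge1$. For $R,R_c\ge0$, an *$(n,R,R_c)$ code* consists of a conditional distribution $F_{M|X_{1:n},J}$ from $\mathcal X^n\times[2^{nR_c}]$ to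 $[2^{nR}]$ and a conditional distribution $G_{Y_{1:n}|M,J}$ from $[2^{nR}]\times[2^{nR_c}]$ to $\mathcal X^n$. With $X_{1:n}\sim p_X^{\otimes n}$ and $J$ uniform on $[2^{nR_c}]$ independent of $X_{1:n}$, it induces a joint law $P^{(n)}$ of $(X_{1:n},J,M,Y_{1:n})$. The code is *fully deterministic* if $R_c=0$ and $F$, $G$ are deterministic. Let $(\mathbf X^{(n,B_n)},\mathbf Y^{(n,B_n)})$ be $B_n$ i.i.d. copies of $(X_{1:n},Y_{1:n})$ under $P^{(n)}$, with $\mathbf Y^{(n,B_n)}$ also read as a word of length $nB_n$ by concatenation. For $R,R_c\ge 0$ and $\Delta>0$, the tuple $(R,R_c,\{B_n\},\Delta)$ is *asymptotically achievable with algorithmic realism* if for every $\varepsilon>0$ there are $(n,R+\varepsilon,R_c)$ codes, $n\ge1$, such that $$\limsup_{n\to\infty}\mathbb E\big[d(\mathbf X^{(n,B_n)},\mathbf Y^{(n,B_n)})\big]\le\Delta+\varepsilon$$ and such that, for every lower semi-computable $p_X^{\otimes *}$-critic $\delta$, $$\sup_{n\ge1}\mathbb E\big[\delta(\mathbf Y^{(n,B_n)})\big]<\infty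 .$$ It is so achievable *with fully deterministic codes* if $R_c=0$ and, for every $\varepsilon>0$, these codes can be chosen fully deterministic. For $\Delta>0$ let $R(\Delta)$ be the infimum of the $R\ge0$ for which there is $R_c\ge0$ such that $(R,R_c,\{B_n\},\Delta)$ is asymptotically achievable with algorithmic realism, let $R_*(\Delta)$ be the infimum of the $R\ge0$ such that $(R,0,\{B_n\},\Delta)$ is so achievable with fully deterministic codes, and let $$R^{(1)}(\Delta)=\min\big\{I(X;Y)\;:\;p_{Y|X}\text{ with }p_Y=p_X,\ \mathbb E[d(X,Y)]\le\Delta\big\},\qquad X\sim p_X,$$ with $R^{(1)}(\Delta)=+\infty$ if there is no such $p_{Y|X}$. Then, for every $\Delta>0$ with $R^{(1)}(\Delta)<H(X)$, $$R(\Delta)=R_*(\Delta)=R^{(1)}(\Delta).$$ -/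

import Mathlib

open Filter Topology

noncomputable section

namespace AlgRealism

/-! ### Computability of real-valued maps -/

/-- The rational `± a / b` coded by a sign bit (`true` for plus), `a ≥ 0` and `b ≥ 1`; the positive
integer `b` is stored as `b - 1`. -/
def toRat (t : Bool × ℕ × ℕ) : ℚ :=
  (if t.1 then 1 else -1) * (t.2.1 : ℚ) / ((t.2.2 : ℚ) + 1)

/-- `f` is the pointwise limit of a nondecreasing computable sequence of rational-valued maps. -/
def LowerSemicomputable {α : Type*} [Primcodable α] (f : α → ℝ) : Prop :=
  ∃ φ : α × ℕ → Bool × ℕ × ℕ, Computable φ ∧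
    (∀ x, Tendsto (fun k : ℕ => ((toRat (φ (x, k)) : ℚ) : ℝ)) atTop (𝓝 (f x))) ∧
    ∀ x k, toRat (φ (x, k)) ≤ toRat (φ (x, k + 1))

/-- A computable real-valued map: it and its opposite are lower semi-computable. -/
def ComputableReal {α : Type*} [Primcodable α] (f : α → ℝ) : Prop :=
  LowerSemicomputable f ∧ LowerSemicomputable (fun x => -f x)

section

variable {X : Type*} [Fintype X]

/-! ### Critics -/

/-- The product distribution `p^{⊗ n}`. -/
def iid (p : X → ℝ) (n : ℕ) (x : Fin n → X) : ℝ := ∏ i, p (x i)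

/-- `p^{⊗ *}`-critics: real functions of nonempty words `x` with `∑_{x ∈ X^n} p^{⊗ n}(x) 2^{δ(x)} ≤ 1`
for every length `n ≥ 1`. The value at the empty word plays no role. -/
def IsCritic (p : X → ℝ) (δ : List X → ℝ) : Prop :=
  ∀ n : ℕ, 1 ≤ n → ∑ x : Fin n → X, iid p n x * (2 : ℝ) ^ δ (List.ofFn x) ≤ 1

/-! ### Information measures, in bits -/

/-- Shannon entropy. -/
def entropy (p : X → ℝ) : ℝ := -∑ x, p x * Real.logb 2 (p x)

/-- Mutual information between input and output when the input has law `p` and the conditional law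
of the output given the input is `W`. -/
def mutualInfo (p : X → ℝ) (W : X → X → ℝ) : ℝ :=
  ∑ x, ∑ y, p x * W x y * Real.logb 2 (p x * W x y / (p x * ∑ x', p x' * W x' y))

/-- Conditional distributions `p_{Y|X}` with `p_Y = p_X` and `E[d(X,Y)] ≤ Δ`. -/
def feasible (p : X → ℝ) (d : X → X → ℝ) (Δ : ℝ) : Set (X → X → ℝ) :=
  {W | (∀ x, W x ∈ stdSimplex ℝ X) ∧ (∀ y, ∑ x, p x * W x y = p y) ∧
    ∑ x, ∑ y, p x * W x y * d x y ≤ Δ}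

/-- The rate-distortion-perception function; it is `⊤` when no conditional distribution is
feasible. -/
def rdp (p : X → ℝ) (d : X → X → ℝ) (Δ : ℝ) : EReal :=
  ⨅ W ∈ feasible p d Δ, (mutualInfo p W : EReal)

/-! ### Codes -/

/-- The number of elements `⌊2^{nR}⌋` of the set `[2^{nR}]`. -/
def size (n : ℕ) (R : ℝ) : ℕ := ⌊(2 : ℝ) ^ ((n : ℝ) * R)⌋₊

variable (X) in
/-- An `(n, R, R_c)` code: `enc x j m` is the conditional probability of message `m` given source
word `x` and common randomness `j`; `dec m j y` is that of the reconstruction `y` given `m`, `j`. -/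
structure Code (n : ℕ) (R Rc : ℝ) where
  enc : (Fin n → X) → Fin (size n Rc) → Fin (size n R) → ℝ
  enc_mem : ∀ x j, enc x j ∈ stdSimplex ℝ (Fin (size n R))
  dec : Fin (size n R) → Fin (size n Rc) → (Fin n → X) → ℝ
  dec_mem : ∀ m j, dec m j ∈ stdSimplex ℝ (Fin n → X)

/-- Both conditional distributions of the code are point masses. -/
def Code.IsDeterministic {n : ℕ} {R Rc : ℝ} (c : Code X n R Rc) : Prop :=
  (∀ x j, ∃ m, c.enc x j m = 1) ∧ ∀ m j, ∃ y, c.dec m j y = 1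

/-- The joint law of source word and reconstruction induced by the code, where the common
randomness is uniform and independent of the source. -/
def Code.law {n : ℕ} {R Rc : ℝ} (c : Code X n R Rc) (p : X → ℝ) (z : (Fin n → X) × (Fin n → X)) :
    ℝ :=
  ∑ j : Fin (size n Rc), ∑ m : Fin (size n R),
    iid p n z.1 * (1 / (size n Rc : ℝ)) * c.enc z.1 j m * c.dec m j z.2

/-- Expectation of `f` over a batch of `b` i.i.d. draws from the finitely supported law `P`. -/
def batchExp {Z : Type*} [Fintype Z] (P : Z → ℝ) (b : ℕ) (f : (Fin b → Z) → ℝ) : ℝ :=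
  ∑ z : Fin b → Z, (∏ k, P (z k)) * f z

/-- Additive distortion between two batches of `b` words of length `n`. -/
def batchDist (d : X → X → ℝ) {n b : ℕ} (z : Fin b → (Fin n → X) × (Fin n → X)) : ℝ :=
  (1 / (b : ℝ)) * ∑ k, (1 / (n : ℝ)) * ∑ t, d ((z k).1 t) ((z k).2 t)

/-- The batch of reconstructions as a single word of length `n * b`. -/
def batchWord {n b : ℕ} (z : Fin b → (Fin n → X) × (Fin n → X)) : List X :=
  (List.ofFn fun k => List.ofFn (z k).2).flatten

/-- Expected distortion of a batch of size `b`. -/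
def expDist (p : X → ℝ) (d : X → X → ℝ) {n : ℕ} {R Rc : ℝ} (c : Code X n R Rc) (b : ℕ) : ℝ :=
  batchExp (c.law p) b (batchDist d)

/-- Expected score given by `δ` to the reconstructions of a batch of size `b`. -/
def expScore (p : X → ℝ) (δ : List X → ℝ) {n : ℕ} {R Rc : ℝ} (c : Code X n R Rc) (b : ℕ) : ℝ :=
  batchExp (c.law p) b fun z => δ (batchWord z)

/-! ### Asymptotic achievability with algorithmic realism -/

/-- A sequence of codes has asymptotic distortion at most `D`, and every lower semi-computable
`p^{⊗ *}`-critic has bounded expected score on the batches of reconstructions. -/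
def MeetsConstraints [Primcodable X] (p : X → ℝ) (d : X → X → ℝ) (B : ℕ → ℕ) (D : ℝ) {R Rc : ℝ}
    (c : ∀ n : ℕ, Code X n R Rc) : Prop :=
  limsup (fun n : ℕ => (expDist p d (c n) (B n) : EReal)) atTop ≤ (D : EReal) ∧
  ∀ δ : List X → ℝ, IsCritic p δ → LowerSemicomputable δ →
    ∃ C : ℝ, ∀ n : ℕ, 1 ≤ n → expScore p δ (c n) (B n) ≤ C

/-- `(R, R_c, (B_n), Δ)` is asymptotically achievable with algorithmic realism. -/
def Achievable [Primcodable X] (p : X → ℝ) (d : X → X → ℝ) (B : ℕ → ℕ) (R Rc Δ : ℝ) : Prop :=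
  ∀ ε : ℝ, 0 < ε → ∃ c : ∀ n : ℕ, Code X n (R + ε) Rc, MeetsConstraints p d B (Δ + ε) c

/-- `(R, (B_n), Δ)` is asymptotically achievable with algorithmic realism by fully deterministic
codes: no common randomness, deterministic encoders and decoders. -/
def DetAchievable [Primcodable X] (p : X → ℝ) (d : X → X → ℝ) (B : ℕ → ℕ) (R Δ : ℝ) : Prop :=
  ∀ ε : ℝ, 0 < ε → ∃ c : ∀ n : ℕ, Code X n (R + ε) 0,
    (∀ n, (c n).IsDeterministic) ∧ MeetsConstraints p d B (Δ + ε) c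

/-- The infimum of rates achievable with some amount of common randomness. -/
def optRate [Primcodable X] (p : X → ℝ) (d : X → X → ℝ) (B : ℕ → ℕ) (Δ : ℝ) : EReal :=
  sInf (Real.toEReal '' {R : ℝ | 0 ≤ R ∧ ∃ Rc : ℝ, 0 ≤ Rc ∧ Achievable p d B R Rc Δ})

/-- The infimum of rates achievable with fully deterministic codes. -/
def optDetRate [Primcodable X] (p : X → ℝ) (d : X → X → ℝ) (B : ℕ → ℕ) (Δ : ℝ) : EReal :=
  sInf (Real.toEReal '' {R : ℝ | 0 ≤ R ∧ DetAchievable p d B R Δ})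

end

end AlgRealism

end

/-! Converse. At a uniformly chosen time the source and reconstruction letters of a code have a
joint law with first marginal `p`; its distortion is that of the code, and its mutual information is
at most the rate (`Code.mutualInfo_letterChannel_le`). An additive score of the batch depends only
on the reconstruction marginal and grows linearly in the length. If some letter `a` stayed
overrepresented, a rational-valued additive critic would therefore be unbounded
(`exists_critic_letter`). So a limit of letter channels has output law at most `p` at each letter,
hence equal to `p`. Compactness and continuity of mutual information conclude.

Achievability. Lower semi-computable critics are countable, and the codes need not be computable, so
the `n`-th code only has to fool a mixture of the critics among the first `n` functions of an
enumeration. The score `log₂ (1 + mixture)` is nonnegative, has bounded mean under the source, grows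
at most linearly with the length, and dominates each included critic up to a constant.

To fool one such score, draw about `2^{n(I + 2γ)}` i.i.d. codewords with law `p^{⊗ n}`. Above rate
`I`, soft covering makes the reverse channel with uniform messages reproduce the source almost
exactly, so its posterior is an encoder with the right distortion and nearly uniform messages. Below
rate `H(X)`, source atoms are typically much lighter than `1/M`, and rounding the posterior at
random to a deterministic map keeps the messages nearly uniform. Uniform messages in a batch are
distinct up to probability `b²/M`, and distinct codewords are i.i.d. source words, so the mean score
over codebooks is the source's own up to errors (`exists_oneShot_code`). These errors decay
exponentially, which beats the subexponential `B n`. -/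

noncomputable section

namespace AlgRealism

/-! ### Expectations under finite product laws -/

/-- Expectation of `f` under the product of the weights `w i`. -/
def prodExp {ι Z : Type*} [Fintype ι] [DecidableEq ι] [Fintype Z] (w : ι → Z → ℝ)
    (f : (ι → Z) → ℝ) : ℝ :=
  ∑ z : ι → Z, (∏ i, w i (z i)) * f z

section prodExp

variable {ι κ Z Y : Type*} [Fintype ι] [DecidableEq ι] [Fintype κ] [DecidableEq κ] [Fintype Z]
  [Fintype Y]

lemma prodExp_prod (w : ι → Z → ℝ) (g : ι → Z → ℝ) :
    prodExp w (fun z => ∏ i, g i (z i)) = ∏ i, ∑ a, w i a * g i a := by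
  classical
  rw [Finset.prod_univ_sum, Fintype.piFinset_univ]
  simp [prodExp, Finset.prod_mul_distrib]

lemma prodExp_mono {w : ι → Z → ℝ} (hw : ∀ i a, 0 ≤ w i a) {f g : (ι → Z) → ℝ}
    (h : ∀ z, f z ≤ g z) : prodExp w f ≤ prodExp w g :=
  Finset.sum_le_sum fun z _ =>
    mul_le_mul_of_nonneg_left (h z) (Finset.prod_nonneg fun i _ => hw i _)

lemma prodExp_add (w : ι → Z → ℝ) (f g : (ι → Z) → ℝ) :
    prodExp w (fun z => f z + g z) = prodExp w f + prodExp w g := by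
  simp [prodExp, mul_add, Finset.sum_add_distrib]

lemma prodExp_const_mul (w : ι → Z → ℝ) (c : ℝ) (f : (ι → Z) → ℝ) :
    prodExp w (fun z => c * f z) = c * prodExp w f := by
  simp only [prodExp, Finset.mul_sum]
  exact Finset.sum_congr rfl fun z _ => by ring

lemma prodExp_sum {T : Type*} (s : Finset T) (w : ι → Z → ℝ) (f : T → (ι → Z) → ℝ) :
    prodExp w (fun z => ∑ t ∈ s, f t z) = ∑ t ∈ s, prodExp w (f t) := by
  simp only [prodExp, Finset.mul_sum]
  exact Finset.sum_comm

lemma prodExp_const {w : ι → Z → ℝ} (hw : ∀ i, ∑ a, w i a = 1) (c : ℝ) :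
    prodExp w (fun _ => c) = c := by
  have h := prodExp_prod w (fun _ _ => 1)
  have h2 := prodExp_const_mul w c (fun _ => 1)
  simp only [Finset.prod_const_one, mul_one, hw] at h h2
  rw [h2, h, mul_one]

lemma prodExp_coord {w : ι → Z → ℝ} (hw : ∀ i, ∑ a, w i a = 1) (i : ι) (g : Z → ℝ) :
    prodExp w (fun z => g (z i)) = ∑ a, w i a * g a := by
  have h := prodExp_prod w (fun j a => if j = i then g a else 1)
  have h1 : ∀ z : ι → Z, (∏ j, if j = i then g (z j) else 1) = g (z i) := fun z => by simp
  simp only [h1] at h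
  rw [h, Finset.prod_eq_single i]
  · simp
  · intro j _ hj
    simp [hj, hw]
  · simp

lemma prodExp_coord_mul {w : ι → Z → ℝ} (hw : ∀ i, ∑ a, w i a = 1) {i j : ι} (hij : i ≠ j)
    (g h : Z → ℝ) :
    prodExp w (fun z => g (z i) * h (z j)) = (∑ a, w i a * g a) * ∑ a, w j a * h a := by
  have H := prodExp_prod w (fun k a => (if k = i then g a else 1) * (if k = j then h a else 1))
  have h1 : ∀ z : ι → Z, (∏ k, (if k = i then g (z k) else 1) * (if k = j then h (z k) else 1))
      = g (z i) * h (z j) := fun z => by rw [Finset.prod_mul_distrib]; simp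
  simp only [h1] at H
  rw [H, ← Finset.prod_subset (Finset.subset_univ {i, j}), Finset.prod_pair hij]
  · simp [hij, hij.symm]
  · intro k _ hk
    simp only [Finset.mem_insert, Finset.mem_singleton, not_or] at hk
    simp [hk.1, hk.2, hw]

/-- Integrate `2m|f| - m² ≤ f²`, where `m` is the mean of `|f|`. -/
lemma sq_prodExp_abs_le {w : ι → Z → ℝ} (hw0 : ∀ i a, 0 ≤ w i a) (hw : ∀ i, ∑ a, w i a = 1)
    (f : (ι → Z) → ℝ) : (prodExp w fun z => |f z|) ^ 2 ≤ prodExp w fun z => f z ^ 2 := by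
  set m := prodExp w fun z => |f z|
  have h : prodExp w (fun z => (2 * m) * |f z| + (-m ^ 2)) ≤ prodExp w fun z => f z ^ 2 :=
    prodExp_mono hw0 fun z => by nlinarith [sq_nonneg (|f z| - m), sq_abs (f z)]
  rw [prodExp_add, prodExp_const_mul, prodExp_const hw] at h
  nlinarith

/-- Mean absolute deviation of a sum of independent variables, by the second moment. -/
lemma prodExp_abs_sum_sub_le {w : ι → Z → ℝ} (hw0 : ∀ i a, 0 ≤ w i a)
    (hw : ∀ i, ∑ a, w i a = 1) (h : ι → Z → ℝ) :
    prodExp w (fun z => |∑ i, h i (z i) - ∑ i, ∑ a, w i a * h i a|) ≤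
      √(∑ i, ∑ a, w i a * h i a ^ 2) := by
  refine Real.le_sqrt_of_sq_le ((sq_prodExp_abs_le hw0 hw _).trans ?_)
  set e : ι → ℝ := fun i => ∑ a, w i a * h i a with he
  have h0 : ∀ i, ∑ a, w i a * (h i a - e i) = 0 := fun i => by
    simp only [mul_sub, Finset.sum_sub_distrib, ← Finset.sum_mul, hw, one_mul]
    simp [he]
  -- In the expanded square, off-diagonal terms vanish by independence and centring; each diagonal
  -- term is a variance, at most the second moment.
  have h1 : (fun z : ι → Z => (∑ i, h i (z i) - ∑ i, e i) ^ 2) = fun z =>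
      ∑ i, ∑ j, (h i (z i) - e i) * (h j (z j) - e j) := by
    funext z
    rw [← Finset.sum_sub_distrib, sq, Finset.sum_mul_sum]
  rw [h1, prodExp_sum]
  refine Finset.sum_le_sum fun i _ => ?_
  rw [prodExp_sum, Finset.sum_eq_single i]
  · rw [prodExp_coord hw i (fun a => (h i a - e i) * (h i a - e i))]
    have : ∑ a, w i a * ((h i a - e i) * (h i a - e i)) =
        ∑ a, w i a * h i a ^ 2 - e i ^ 2 - 2 * e i * ∑ a, w i a * (h i a - e i) := by
      have h3 : ∀ a, w i a * ((h i a - e i) * (h i a - e i)) =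
          w i a * h i a ^ 2 - w i a * e i ^ 2 - 2 * e i * (w i a * (h i a - e i)) :=
        fun a => by ring
      simp only [h3, Finset.sum_sub_distrib, ← Finset.sum_mul, ← Finset.mul_sum, hw, one_mul]
    rw [this, h0]
    nlinarith [sq_nonneg (e i)]
  · intro j _ hj
    rw [prodExp_coord_mul hw (Ne.symm hj) (fun a => h i a - e i) (fun a => h j a - e j), h0,
      zero_mul]
  · simp

/-- Images of independent variables are independent. -/
lemma prodExp_comp [DecidableEq Y] (w : ι → Z → ℝ) (φ : Z → Y) (g : (ι → Y) → ℝ) :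
    prodExp w (fun z => g (fun k => φ (z k))) =
      prodExp (fun k y => ∑ a, if φ a = y then w k a else 0) g := by
  classical
  unfold prodExp
  simp_rw [Finset.prod_univ_sum, Fintype.piFinset_univ, Finset.sum_mul]
  rw [Finset.sum_comm]
  refine Finset.sum_congr rfl fun z _ => ?_
  rw [Finset.sum_eq_single (fun k => φ (z k))]
  · simp
  · intro y _ hy
    obtain ⟨k, hk⟩ : ∃ k, φ (z k) ≠ y k := by
      by_contra! h
      exact hy (funext fun k => (h k).symm)
    rw [Finset.prod_eq_zero (Finset.mem_univ k) (if_neg hk), zero_mul]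
  · simp

/-- The marginal of a product law along an injection of the index set. -/
lemma prodExp_comp_injective {w : ι → Z → ℝ} (hw : ∀ i, ∑ a, w i a = 1) {e : κ → ι}
    (he : Function.Injective e) (f : (κ → Z) → ℝ) :
    prodExp w (fun z => f (fun k => z (e k))) = prodExp (fun k => w (e k)) f := by
  classical
  -- By linearity, point indicators suffice. They factor over `ι`, and coordinates outside the range
  -- of `e` contribute total mass one.
  have key : ∀ b : κ → Z, prodExp w (fun z => ∏ k, if z (e k) = b k then (1 : ℝ) else 0) =
      ∏ k, w (e k) (b k) := by
    intro b
    have H := prodExp_prod w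
      (fun i a => ∏ k, if e k = i then (if a = b k then (1 : ℝ) else 0) else 1)
    have h1 : ∀ z : ι → Z, (∏ i, ∏ k, if e k = i then (if z i = b k then (1 : ℝ) else 0) else 1) =
        ∏ k, if z (e k) = b k then (1 : ℝ) else 0 := by
      intro z
      rw [Finset.prod_comm]
      simp
    simp only [h1] at H
    rw [H, ← Finset.prod_subset (Finset.subset_univ (Finset.univ.image e)),
      Finset.prod_image fun x _ y _ h => he h]
    · refine Finset.prod_congr rfl fun k _ => ?_
      have : ∀ a, (∏ k', if e k' = e k then (if a = b k' then (1 : ℝ) else 0) else 1) =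
          if a = b k then 1 else 0 := fun a => by
        rw [Finset.prod_eq_single k]
        · simp
        · intro k' _ hk'
          simp [he.ne hk']
        · simp
      simp [this]
    · intro i _ hi
      have : ∀ k, e k ≠ i := fun k hk => hi (Finset.mem_image.2 ⟨k, Finset.mem_univ _, hk⟩)
      simp [this, hw]
  have hf : (fun z : ι → Z => f fun k => z (e k)) = fun z =>
      ∑ b : κ → Z, f b * ∏ k, if z (e k) = b k then (1 : ℝ) else 0 := by
    funext z
    rw [Finset.sum_eq_single (fun k => z (e k))]
    · simp
    · intro b _ hb
      obtain ⟨k, hk⟩ : ∃ k, z (e k) ≠ b k := by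
        by_contra! h
        exact hb (funext fun k => (h k).symm)
      rw [Finset.prod_eq_zero (Finset.mem_univ k) (if_neg hk), mul_zero]
    · simp
  rw [hf, prodExp_sum]
  simp only [prodExp_const_mul, key]
  exact Finset.sum_congr rfl fun b _ => mul_comm _ _

/-- Total variation between powers of two laws. -/
lemma sum_abs_prod_sub_prod_le {P Q : Z → ℝ} (hP0 : ∀ a, 0 ≤ P a) (hP : ∑ a, P a = 1)
    (hQ0 : ∀ a, 0 ≤ Q a) (hQ : ∑ a, Q a = 1) (b : ℕ) :
    ∑ z : Fin b → Z, |∏ k, P (z k) - ∏ k, Q (z k)| ≤ b * ∑ a, |P a - Q a| := by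
  induction b with
  | zero => simp
  | succ b ih =>
    rw [← (Fin.consEquiv fun _ : Fin (b + 1) => Z).sum_comp, Fintype.sum_prod_type]
    simp only [Fin.consEquiv_apply, Fin.prod_univ_succ, Fin.cons_zero, Fin.cons_succ]
    -- Hybrid argument: change the tail under `P`, then the head factor.
    have hb : ∀ (a : Z) (z : Fin b → Z),
        |P a * ∏ k, P (z k) - Q a * ∏ k, Q (z k)| ≤
          P a * |∏ k, P (z k) - ∏ k, Q (z k)| + |P a - Q a| * ∏ k, Q (z k) := by
      intro a z
      have h1 : P a * ∏ k, P (z k) - Q a * ∏ k, Q (z k) =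
          P a * (∏ k, P (z k) - ∏ k, Q (z k)) + (P a - Q a) * ∏ k, Q (z k) := by ring
      rw [h1]
      refine (abs_add_le _ _).trans (le_of_eq ?_)
      rw [abs_mul, abs_mul, abs_of_nonneg (hP0 a),
        abs_of_nonneg (Finset.prod_nonneg fun k _ => hQ0 (z k))]
    have h1 : ∑ z : Fin b → Z, ∏ k, Q (z k) = 1 := by
      have := prodExp_const (w := fun _ : Fin b => Q) (fun _ => hQ) 1
      simpa [prodExp] using this
    calc _ ≤ ∑ a, ∑ z : Fin b → Z,
          (P a * |∏ k, P (z k) - ∏ k, Q (z k)| + |P a - Q a| * ∏ k, Q (z k)) :=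
          Finset.sum_le_sum fun a _ => Finset.sum_le_sum fun z _ => hb a z
      _ = (∑ z : Fin b → Z, |∏ k, P (z k) - ∏ k, Q (z k)|) + ∑ a, |P a - Q a| := by
          simp only [Finset.sum_add_distrib, ← Finset.mul_sum, ← Finset.sum_mul, h1, hP, one_mul,
            mul_one]
      _ ≤ _ := by push_cast; linarith

/-- A random variable is somewhere at most its expectation. -/
lemma exists_le_of_prodExp_le {w : ι → Z → ℝ} (hw0 : ∀ i a, 0 ≤ w i a)
    (hw : ∀ i, ∑ a, w i a = 1) {f : (ι → Z) → ℝ} {c : ℝ} (h : prodExp w f ≤ c) :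
    ∃ z, f z ≤ c := by
  by_contra! hc
  have h2 : ∑ z : ι → Z, (∏ i, w i (z i)) * (f z - c) ≤ 0 := by
    have := prodExp_add w f (fun _ => -c)
    rw [prodExp_const hw] at this
    simp only [prodExp, ← sub_eq_add_neg] at this h
    linarith
  have h3 : ∀ z ∈ Finset.univ, 0 ≤ (∏ i, w i (z i)) * (f z - c) := fun z _ =>
    mul_nonneg (Finset.prod_nonneg fun i _ => hw0 i _) (sub_pos.2 (hc z)).le
  have h4 := (Finset.sum_eq_zero_iff_of_nonneg h3).1 (le_antisymm h2 (Finset.sum_nonneg h3))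
  have h5 : ∑ z : ι → Z, ∏ i, w i (z i) = 0 := Finset.sum_eq_zero fun z hz =>
    (mul_eq_zero.1 (h4 z hz)).resolve_right (sub_pos.2 (hc z)).ne'
  have h6 := prodExp_const hw 1
  simp [prodExp, h5] at h6

end prodExp

/-! ### One-shot lossy compression with near-uniform messages -/

section oneShot

/-- Truncation: the part `h₁` is controlled by its variance, while the rare large part `h₂ ≥ 0` is
charged its mean twice, once for itself and once for its centring. -/
lemma prodExp_abs_sum_sub_le_split {ι Z : Type*} [Fintype ι] [DecidableEq ι] [Fintype Z]
    {w : ι → Z → ℝ} (hw0 : ∀ i a, 0 ≤ w i a) (hw : ∀ i, ∑ a, w i a = 1) (h₁ h₂ : ι → Z → ℝ)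
    (h₂0 : ∀ i a, 0 ≤ h₂ i a) :
    prodExp w (fun z => |∑ i, (h₁ i (z i) + h₂ i (z i)) - ∑ i, ∑ a, w i a * (h₁ i a + h₂ i a)|) ≤
      √(∑ i, ∑ a, w i a * h₁ i a ^ 2) + 2 * ∑ i, ∑ a, w i a * h₂ i a := by
  have h2 : prodExp w (fun z => ∑ i, h₂ i (z i)) = ∑ i, ∑ a, w i a * h₂ i a := by
    rw [prodExp_sum]
    exact Finset.sum_congr rfl fun i _ => prodExp_coord hw i (h₂ i)
  set e := ∑ i, ∑ a, w i a * h₂ i a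
  have he : 0 ≤ e := Finset.sum_nonneg fun i _ => Finset.sum_nonneg fun a _ =>
    mul_nonneg (hw0 i a) (h₂0 i a)
  calc _ ≤ prodExp w (fun z => |∑ i, h₁ i (z i) - ∑ i, ∑ a, w i a * h₁ i a| +
        (∑ i, h₂ i (z i) + e)) := by
        refine prodExp_mono hw0 fun z => ?_
        have h3 : ∑ i, ∑ a, w i a * (h₁ i a + h₂ i a) = ∑ i, ∑ a, w i a * h₁ i a + e := by
          simp only [mul_add, Finset.sum_add_distrib, e]
        have h4 : 0 ≤ ∑ i, h₂ i (z i) := Finset.sum_nonneg fun i _ => h₂0 i _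
        rw [h3, Finset.sum_add_distrib, abs_le]
        have h5 := le_abs_self (∑ i, h₁ i (z i) - ∑ i, ∑ a, w i a * h₁ i a)
        have h6 := neg_abs_le (∑ i, h₁ i (z i) - ∑ i, ∑ a, w i a * h₁ i a)
        constructor <;> linarith
    _ = prodExp w (fun z => |∑ i, h₁ i (z i) - ∑ i, ∑ a, w i a * h₁ i a|) + (e + e) := by
        rw [prodExp_add, prodExp_add, prodExp_const hw, h2]
    _ ≤ _ := by linarith [prodExp_abs_sum_sub_le hw0 hw h₁]

variable {A : Type*} [Fintype A] {M : ℕ}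

/-- Soft covering: the output law of a uniformly chosen word of an i.i.d. codebook. -/
lemma soft_covering (hM : 0 < M) {μ : A → ℝ} (hμ : ∀ a, 0 < μ a) (hμ1 : ∑ a, μ a = 1)
    {J : A → A → ℝ} (hJ : ∀ x y, 0 ≤ J x y) (hJ1 : ∀ x, ∑ y, J x y = μ x) {K : ℝ} (hK : 0 ≤ K) :
    prodExp (fun _ : Fin M => μ) (fun C => ∑ x, |∑ m, 1 / (M : ℝ) * (J x (C m) / μ (C m)) - μ x|) ≤
      2 * (∑ x, ∑ y, if K * (μ x * μ y) < J x y then J x y else 0) + √(K / M) := by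
  have hM' : (0 : ℝ) < M := by exact_mod_cast hM
  rw [prodExp_sum, Finset.mul_sum]
  have hK1 : √(K / M) = ∑ x, √(K / M) * μ x := by rw [← Finset.mul_sum, hμ1, mul_one]
  rw [hK1, ← Finset.sum_add_distrib]
  refine Finset.sum_le_sum fun x _ => ?_
  -- Split at information density `K`. Pairs above the threshold are charged by their mean; below
  -- it, the density bound gives second moment at most `(K / M) * μ x ^ 2`.
  set h₂ : Fin M → A → ℝ := fun _ y =>
    if K * (μ x * μ y) < J x y then 1 / (M : ℝ) * (J x y / μ y) else 0 with hh₂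
  set h₁ : Fin M → A → ℝ := fun _ y =>
    if K * (μ x * μ y) < J x y then 0 else 1 / (M : ℝ) * (J x y / μ y) with hh₁
  have h12 : ∀ m y, h₁ m y + h₂ m y = 1 / (M : ℝ) * (J x y / μ y) := fun m y => by
    simp only [hh₁, hh₂]; split_ifs <;> simp
  have hV : ∀ y, 0 ≤ 1 / (M : ℝ) * (J x y / μ y) := fun y =>
    mul_nonneg (by positivity) (div_nonneg (hJ x y) (hμ y).le)
  have hV1 : ∀ y, μ y * (1 / (M : ℝ) * (J x y / μ y)) = 1 / M * J x y := fun y => by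
    have := (hμ y).ne'
    field_simp
  have key := prodExp_abs_sum_sub_le_split (w := fun _ : Fin M => μ) (fun _ a => (hμ a).le)
    (fun _ => hμ1) h₁ h₂ (fun m y => by simp only [hh₂]; split_ifs; exacts [hV y, le_rfl])
  simp only [h12, hV1] at key
  have e1 : ∑ _m : Fin M, ∑ y, 1 / (M : ℝ) * J x y = μ x := by
    rw [← Finset.mul_sum, hJ1, Finset.sum_const, Finset.card_univ, Fintype.card_fin, nsmul_eq_mul]
    field_simp
  have e2 : ∑ m : Fin M, ∑ y, μ y * h₂ m y = ∑ y, if K * (μ x * μ y) < J x y then J x y else 0 := by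
    have : ∀ (m : Fin M) y, μ y * h₂ m y =
        1 / M * (if K * (μ x * μ y) < J x y then J x y else 0) := fun m y => by
      simp only [hh₂]; split_ifs
      · exact hV1 y
      · simp
    simp only [this]
    rw [← Finset.mul_sum, Finset.sum_const, Finset.card_univ, Fintype.card_fin, nsmul_eq_mul]
    field_simp
  have e3 : ∑ m : Fin M, ∑ y, μ y * h₁ m y ^ 2 ≤ (K / M) * μ x ^ 2 := by
    have : ∀ (m : Fin M) y, μ y * h₁ m y ^ 2 ≤ (K * μ x / M) * (1 / M * J x y) := fun m y => by
      simp only [hh₁]; split_ifs with h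
      · have := hJ x y
        have := (hμ x).le
        simp only [ne_eq, OfNat.ofNat_ne_zero, not_false_eq_true, zero_pow, mul_zero]
        positivity
      · rw [sq, ← mul_assoc, hV1 y, mul_comm]
        refine mul_le_mul_of_nonneg_right ?_ (mul_nonneg (by positivity) (hJ x y))
        rw [one_div_mul_eq_div]
        refine div_le_div_of_nonneg_right ?_ hM'.le
        rw [div_le_iff₀ (hμ y)]
        linarith
    refine (Finset.sum_le_sum fun m _ => Finset.sum_le_sum fun y _ => this m y).trans
      (le_of_eq ?_)
    simp only [← Finset.mul_sum, hJ1]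
    rw [Finset.sum_const, Finset.card_univ, Fintype.card_fin, nsmul_eq_mul]
    field_simp
  rw [e1, e2] at key
  refine key.trans ?_
  have h3 := Real.sqrt_le_sqrt e3
  rw [Real.sqrt_mul (by positivity), Real.sqrt_sq (hμ x).le] at h3
  linarith

/-- Random rounding of a stochastic encoder. -/
lemma random_rounding [DecidableEq A] {μ : A → ℝ} (hμ : ∀ a, 0 ≤ μ a) (hμ1 : ∑ a, μ a = 1)
    {F : A → Fin M → ℝ} (hF0 : ∀ x m, 0 ≤ F x m) (hF1 : ∀ x, ∑ m, F x m = 1) {θ : ℝ}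
    (hθ : 0 ≤ θ) :
    prodExp F (fun f => ∑ m, |(∑ x, if f x = m then μ x else 0) - ∑ x, μ x * F x m|) ≤
      2 * (∑ x, if θ < μ x then μ x else 0) + √(M * θ) := by
  rw [prodExp_sum]
  -- Here the split is by source atoms: those heavier than `θ` are charged by mass, the others
  -- fluctuate little.
  set h₂ : Fin M → A → Fin M → ℝ := fun m x m' =>
    if m' = m then (if θ < μ x then μ x else 0) else 0 with hh₂
  set h₁ : Fin M → A → Fin M → ℝ := fun m x m' =>
    if m' = m then (if θ < μ x then 0 else μ x) else 0 with hh₁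
  have h12 : ∀ m x m', h₁ m x m' + h₂ m x m' = if m' = m then μ x else 0 := fun m x m' => by
    simp only [hh₁, hh₂]; split_ifs <;> simp
  have e1 : ∀ m x, (∑ m', F x m' * if m' = m then μ x else 0) = μ x * F x m := fun m x => by
    simp [mul_comm]
  have e2 : ∀ m x, ∑ m', F x m' * h₂ m x m' = F x m * if θ < μ x then μ x else 0 := fun m x => by
    simp [hh₂]
  have e3 : ∀ m, ∑ x, ∑ m', F x m' * h₁ m x m' ^ 2 ≤ θ * ∑ x, μ x * F x m := fun m => by
    rw [Finset.mul_sum]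
    refine Finset.sum_le_sum fun x _ => ?_
    rw [Finset.sum_eq_single m (fun m' _ hm' => by simp [hh₁, hm']) (by simp)]
    simp only [hh₁, if_true]
    have h1 := hF0 x m
    have h2 := hμ x
    split_ifs with h
    · simp only [ne_eq, OfNat.ofNat_ne_zero, not_false_eq_true, zero_pow, mul_zero]
      positivity
    · have h4 : μ x * μ x ≤ θ * μ x := mul_le_mul_of_nonneg_right (not_lt.1 h) h2
      nlinarith
  have key : ∀ m, prodExp F (fun f => |(∑ x, if f x = m then μ x else 0) - ∑ x, μ x * F x m|) ≤
      √(θ * ∑ x, μ x * F x m) + 2 * ∑ x, F x m * if θ < μ x then μ x else 0 := fun m => by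
    have := prodExp_abs_sum_sub_le_split hF0 hF1 (h₁ m) (h₂ m)
      (fun x m' => by
        simp only [hh₂]
        split_ifs
        exacts [hμ x, le_rfl, le_rfl])
    simp only [h12, e1, e2] at this
    linarith [Real.sqrt_le_sqrt (e3 m)]
  refine (Finset.sum_le_sum fun m _ => key m).trans ?_
  rw [Finset.sum_add_distrib, ← Finset.mul_sum, Finset.sum_comm (s := Finset.univ (α := Fin M))]
  simp only [← Finset.sum_mul, hF1, one_mul]
  have hsum : ∑ m : Fin M, ∑ x, μ x * F x m = 1 := by
    rw [Finset.sum_comm]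
    simp only [← Finset.mul_sum, hF1, mul_one, hμ1]
  -- Cauchy–Schwarz over the `M` messages, whose probabilities sum to one.
  have hsq : ∑ m : Fin M, √(θ * ∑ x, μ x * F x m) ≤ √(M * θ) := by
    refine Real.le_sqrt_of_sq_le ?_
    refine sq_sum_le_card_mul_sum_sq.trans (le_of_eq ?_)
    have h0 : ∀ m, √(θ * ∑ x, μ x * F x m) ^ 2 = θ * ∑ x, μ x * F x m := fun m =>
      Real.sq_sqrt (mul_nonneg hθ (Finset.sum_nonneg fun x _ => mul_nonneg (hμ x) (hF0 x m)))
    simp only [h0, ← Finset.mul_sum, hsum]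
    simp
  linarith

/-- Birthday bound: a union over ordered pairs of indices, each colliding with probability `1 / M`.
-/
lemma prodExp_uniform_not_injective_le (hM : 0 < M) (b : ℕ)
    [DecidablePred fun m : Fin b → Fin M => Function.Injective m] :
    prodExp (fun (_ : Fin b) (_ : Fin M) => 1 / (M : ℝ))
      (fun m => if Function.Injective m then 0 else 1) ≤ (b : ℝ) ^ 2 / M := by
  have hM' : (0 : ℝ) < M := by exact_mod_cast hM
  have hU : ∀ _ : Fin b, ∑ _m : Fin M, 1 / (M : ℝ) = 1 := fun _ => by
    rw [Finset.sum_const, Finset.card_univ, Fintype.card_fin, nsmul_eq_mul]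
    field_simp
  have h1 : ∀ m : Fin b → Fin M, (if Function.Injective m then (0 : ℝ) else 1) ≤
      ∑ i, ∑ j, if i = j then 0 else ∑ c, (if m i = c then 1 else 0) * (if m j = c then 1 else 0) := by
    intro m
    have h0 : ∀ i j, (0 : ℝ) ≤ if i = j then 0 else
        ∑ c, (if m i = c then 1 else 0) * (if m j = c then 1 else 0) := fun i j => by
      split_ifs
      · exact le_rfl
      · exact Finset.sum_nonneg fun c _ => by positivity
    split_ifs with h
    · exact Finset.sum_nonneg fun i _ => Finset.sum_nonneg fun j _ => h0 i j
    · simp only [Function.Injective, not_forall] at h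
      obtain ⟨i, j, hij, hne⟩ := h
      refine le_trans ?_ (Finset.single_le_sum (fun i _ => Finset.sum_nonneg fun j _ => h0 i j)
        (Finset.mem_univ i))
      refine le_trans ?_ (Finset.single_le_sum (fun j _ => h0 i j) (Finset.mem_univ j))
      simp [hne, hij]
  refine (prodExp_mono (fun _ _ => by positivity) h1).trans ?_
  rw [prodExp_sum]
  have h2 : ∀ i j : Fin b, prodExp (fun (_ : Fin b) (_ : Fin M) => 1 / (M : ℝ)) (fun m =>
      if i = j then 0 else ∑ c, (if m i = c then 1 else 0) * (if m j = c then 1 else 0)) ≤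
      1 / M := by
    intro i j
    split_ifs with h
    · rw [prodExp_const hU]; positivity
    · rw [prodExp_sum]
      have : ∀ c : Fin M, prodExp (fun (_ : Fin b) (_ : Fin M) => 1 / (M : ℝ)) (fun m =>
          (if m i = c then 1 else 0) * (if m j = c then 1 else 0)) = 1 / M * (1 / M) := fun c => by
        rw [prodExp_coord_mul hU h (fun a => if a = c then 1 else 0)
          (fun a => if a = c then 1 else 0)]
        simp
      simp only [this]
      rw [Finset.sum_const, Finset.card_univ, Fintype.card_fin, nsmul_eq_mul]
      exact le_of_eq (by field_simp)
  calc _ ≤ ∑ _i : Fin b, ∑ _j : Fin b, 1 / (M : ℝ) := Finset.sum_le_sum fun i _ => by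
        rw [prodExp_sum]
        exact Finset.sum_le_sum fun j _ => h2 i j
    _ = _ := by
        simp only [Finset.sum_const, Finset.card_univ, Fintype.card_fin, nsmul_eq_mul]
        ring

/-- Batches of uniformly chosen words of an i.i.d. codebook. -/
lemma prodExp_uniform_batch_le (hM : 0 < M) {μ : A → ℝ} (hμ : ∀ a, 0 ≤ μ a) (hμ1 : ∑ a, μ a = 1)
    {b : ℕ} {g : (Fin b → A) → ℝ} (hg0 : ∀ z, 0 ≤ g z) {G E : ℝ} (hG : ∀ z, g z ≤ G)
    (hE : prodExp (fun _ => μ) g ≤ E) :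
    prodExp (fun _ : Fin M => μ) (fun C =>
      prodExp (fun (_ : Fin b) (_ : Fin M) => 1 / (M : ℝ)) fun m => g fun k => C (m k)) ≤
      E + G * ((b : ℝ) ^ 2 / M) := by
  classical
  have hM' : (0 : ℝ) < M := by exact_mod_cast hM
  have hU : ∀ _ : Fin b, ∑ _m : Fin M, 1 / (M : ℝ) = 1 := fun _ => by
    rw [Finset.sum_const, Finset.card_univ, Fintype.card_fin, nsmul_eq_mul]
    field_simp
  have hE0 : 0 ≤ E := by
    refine le_trans ?_ hE
    exact Finset.sum_nonneg fun z _ =>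
      mul_nonneg (Finset.prod_nonneg fun _ _ => hμ _) (hg0 z)
  have hG0 : 0 ≤ G := by
    by_contra! h
    have := prodExp_mono (w := fun _ : Fin b => μ) (fun _ a => hμ a) hG
    rw [prodExp_const fun _ => hμ1] at this
    have h2 : (0 : ℝ) ≤ prodExp (fun _ => μ) g := Finset.sum_nonneg fun z _ =>
      mul_nonneg (Finset.prod_nonneg fun _ _ => hμ _) (hg0 z)
    linarith
  -- The codebook is averaged first, with the messages fixed: distinct messages select i.i.d. words
  -- of law `μ`, and colliding ones fall back on the bound `G`.
  have h1 : ∀ m : Fin b → Fin M, prodExp (fun _ : Fin M => μ) (fun C => g fun k => C (m k)) ≤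
      E + G * (if Function.Injective m then 0 else 1) := by
    intro m
    split_ifs with h
    · rw [prodExp_comp_injective (fun _ => hμ1) h g]
      simpa using hE
    · have := prodExp_mono (w := fun _ : Fin M => μ) (fun _ a => hμ a)
        (fun C => hG fun k => C (m k))
      rw [prodExp_const fun _ => hμ1] at this
      linarith
  calc _ = prodExp (fun (_ : Fin b) (_ : Fin M) => 1 / (M : ℝ)) (fun m =>
        prodExp (fun _ : Fin M => μ) (fun C => g fun k => C (m k))) := by
        simp only [prodExp, Finset.mul_sum]
        rw [Finset.sum_comm]
        refine Finset.sum_congr rfl fun m _ => Finset.sum_congr rfl fun C _ => by ring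
    _ ≤ prodExp (fun (_ : Fin b) (_ : Fin M) => 1 / (M : ℝ)) (fun m =>
        E + G * (if Function.Injective m then 0 else 1)) :=
        prodExp_mono (fun _ _ => by positivity) h1
    _ ≤ _ := by
        rw [prodExp_add, prodExp_const hU, prodExp_const_mul]
        gcongr
        exact prodExp_uniform_not_injective_le hM b

/-- Given a codebook, some deterministic encoder has small distortion and nearly uniform
messages. -/
lemma exists_encoder (hM : 0 < M) {μ : A → ℝ} (hμ : ∀ a, 0 < μ a) (hμ1 : ∑ a, μ a = 1)
    {J : A → A → ℝ} (hJ : ∀ x y, 0 ≤ J x y) (hJ2 : ∀ y, ∑ x, J x y = μ y)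
    {D : A → A → ℝ} (hD0 : ∀ x y, 0 ≤ D x y) {Dm : ℝ} (hDm : ∀ x y, D x y ≤ Dm) {θ : ℝ}
    (hθ : 0 ≤ θ) {c : ℝ} (hc : 0 ≤ c) (C : Fin M → A) :
    ∃ f : A → Fin M, ∑ x, μ x * D x (C (f x)) +
        c * ∑ m, |(∑ x, if f x = m then μ x else 0) - 1 / (M : ℝ)| ≤
      (∑ m, 1 / (M : ℝ) * ∑ x, J x (C m) / μ (C m) * D x (C m)) +
        Dm * (∑ x, |∑ m, 1 / (M : ℝ) * (J x (C m) / μ (C m)) - μ x|) +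
        c * (2 * (∑ x, if θ < μ x then μ x else 0) + √(M * θ) +
          ∑ x, |∑ m, 1 / (M : ℝ) * (J x (C m) / μ (C m)) - μ x|) := by
  classical
  have hM' : (0 : ℝ) < M := by exact_mod_cast hM
  -- `q` is the ideal joint law: a uniform message, then a source word drawn from the reverse
  -- channel of its codeword. `F` is the posterior of the message, set to uniform where it is
  -- undefined.
  set q : A → Fin M → ℝ := fun x m => 1 / (M : ℝ) * (J x (C m) / μ (C m)) with hq
  have hq0 : ∀ x m, 0 ≤ q x m := fun x m =>
    mul_nonneg (by positivity) (div_nonneg (hJ x _) (hμ _).le)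
  set F : A → Fin M → ℝ := fun x m =>
    if ∑ m, q x m = 0 then 1 / (M : ℝ) else q x m / ∑ m, q x m with hF
  have hF0 : ∀ x m, 0 ≤ F x m := fun x m => by
    simp only [hF]; split_ifs
    · positivity
    · exact div_nonneg (hq0 x m) (Finset.sum_nonneg fun m _ => hq0 x m)
  have hF1 : ∀ x, ∑ m, F x m = 1 := fun x => by
    simp only [hF]; split_ifs with h
    · rw [Finset.sum_const, Finset.card_univ, Fintype.card_fin, nsmul_eq_mul]
      field_simp
    · rw [← Finset.sum_div, div_self h]
  have hqF : ∀ x m, (∑ m, q x m) * F x m = q x m := fun x m => by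
    simp only [hF]; split_ifs with h
    · rw [h, zero_mul]
      exact ((Finset.sum_eq_zero_iff_of_nonneg fun m _ => hq0 x m).1 h m (Finset.mem_univ m)).symm
    · field_simp
  have hq1 : ∀ m, ∑ x, q x m = 1 / M := fun m => by
    simp only [hq]
    rw [← Finset.mul_sum, ← Finset.sum_div, hJ2, div_self (hμ _).ne', mul_one]
  set T := ∑ x, |∑ m, q x m - μ x| with hT
  have hdist : ∑ x, ∑ m, F x m * (μ x * D x (C m)) ≤
      (∑ m, 1 / (M : ℝ) * ∑ x, J x (C m) / μ (C m) * D x (C m)) + Dm * T := by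
    have h1 : ∀ x, ∑ m, F x m * (μ x * D x (C m)) ≤
        ∑ m, q x m * D x (C m) + Dm * |∑ m, q x m - μ x| := fun x => by
      have h2 : Dm * |∑ m, q x m - μ x| = ∑ m, F x m * (Dm * |∑ m, q x m - μ x|) := by
        rw [← Finset.sum_mul, hF1, one_mul]
      rw [h2, ← Finset.sum_add_distrib]
      refine Finset.sum_le_sum fun m _ => ?_
      rw [← hqF x m]
      have h3 : (μ x - ∑ m, q x m) * D x (C m) ≤ Dm * |∑ m, q x m - μ x| := by
        rw [mul_comm Dm, abs_sub_comm]
        exact (mul_le_mul_of_nonneg_right (le_abs_self _) (hD0 _ _)).trans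
          (mul_le_mul_of_nonneg_left (hDm _ _) (abs_nonneg _))
      nlinarith [mul_le_mul_of_nonneg_left h3 (hF0 x m)]
    refine (Finset.sum_le_sum fun x _ => h1 x).trans (le_of_eq ?_)
    rw [Finset.sum_add_distrib, ← Finset.mul_sum, Finset.sum_comm]
    congr 1
    refine Finset.sum_congr rfl fun m _ => ?_
    rw [Finset.mul_sum]
    exact Finset.sum_congr rfl fun x _ => by simp only [hq]; ring
  -- Data processing: `F` sends the source marginal of `q` to exactly uniform messages, and `μ` is
  -- at distance `T` from that marginal.
  have htv : ∑ m, |∑ x, μ x * F x m - 1 / (M : ℝ)| ≤ T := by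
    have h1 : ∀ m, |∑ x, μ x * F x m - 1 / (M : ℝ)| ≤ ∑ x, |∑ m, q x m - μ x| * F x m :=
        fun m => by
      rw [← hq1 m, ← Finset.sum_sub_distrib]
      refine (Finset.abs_sum_le_sum_abs _ _).trans (Finset.sum_le_sum fun x _ => ?_)
      rw [← hqF x m, ← sub_mul, abs_mul, abs_of_nonneg (hF0 x m), abs_sub_comm]
    refine (Finset.sum_le_sum fun m _ => h1 m).trans (le_of_eq ?_)
    rw [Finset.sum_comm]
    simp only [← Finset.mul_sum, hF1, mul_one, hT]
  refine exists_le_of_prodExp_le hF0 hF1 ?_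
  rw [prodExp_add, prodExp_const_mul, prodExp_sum]
  have e1 : ∀ x, prodExp F (fun f => μ x * D x (C (f x))) = ∑ m, F x m * (μ x * D x (C m)) :=
    fun x => prodExp_coord hF1 x (fun m => μ x * D x (C m))
  simp only [e1]
  refine add_le_add hdist (mul_le_mul_of_nonneg_left ?_ hc)
  calc _ ≤ prodExp F (fun f => (∑ m, |(∑ x, if f x = m then μ x else 0) - ∑ x, μ x * F x m|) + T) := by
        refine prodExp_mono hF0 fun f => ?_
        refine le_trans ?_ (add_le_add le_rfl htv)
        rw [← Finset.sum_add_distrib]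
        exact Finset.sum_le_sum fun m _ => abs_sub_le _ _ _
    _ ≤ _ := by
        rw [prodExp_add, prodExp_const hF1]
        linarith [random_rounding (fun a => (hμ a).le) hμ1 hF0 hF1 hθ]

/-- One-shot random coding: a codebook and a deterministic encoder for which a weighted sum of the
expected distortion and of the expected score of a batch is small. -/
theorem exists_oneShot_code (hM : 0 < M) {μ : A → ℝ} (hμ : ∀ a, 0 < μ a) (hμ1 : ∑ a, μ a = 1)
    {J : A → A → ℝ} (hJ : ∀ x y, 0 ≤ J x y) (hJ1 : ∀ x, ∑ y, J x y = μ x)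
    (hJ2 : ∀ y, ∑ x, J x y = μ y)
    {D : A → A → ℝ} (hD0 : ∀ x y, 0 ≤ D x y) {Dm : ℝ} (hDm0 : 0 ≤ Dm) (hDm : ∀ x y, D x y ≤ Dm)
    {b : ℕ} {g : (Fin b → A) → ℝ} (hg0 : ∀ z, 0 ≤ g z) {G E : ℝ} (hG0 : 0 ≤ G) (hG : ∀ z, g z ≤ G)
    (hE : prodExp (fun _ => μ) g ≤ E) {K θ c : ℝ} (hK : 0 ≤ K) (hθ : 0 ≤ θ) (hc : 0 ≤ c)
    {η₁ η₂ : ℝ} (hη₁ : 2 * (∑ x, ∑ y, if K * (μ x * μ y) < J x y then J x y else 0) + √(K / M) ≤ η₁)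
    (hη₂ : 2 * (∑ x, if θ < μ x then μ x else 0) + √(M * θ) ≤ η₂) :
    ∃ (C : Fin M → A) (f : A → Fin M), ∑ x, μ x * D x (C (f x)) +
        c * prodExp (fun _ : Fin b => μ) (fun x => g fun k => C (f (x k))) ≤
      (∑ x, ∑ y, J x y * D x y) + Dm * η₁ +
        c * (E + G * ((b : ℝ) ^ 2 / M) + G * (b * (η₁ + η₂))) := by
  have hM' : (0 : ℝ) < M := by exact_mod_cast hM
  have hμ0 : ∀ a, 0 ≤ μ a := fun a => (hμ a).le
  have hU : ∑ _m : Fin M, 1 / (M : ℝ) = 1 := by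
    rw [Finset.sum_const, Finset.card_univ, Fintype.card_fin, nsmul_eq_mul]
    field_simp
  set T : (Fin M → A) → ℝ := fun C => ∑ x, |∑ m, 1 / (M : ℝ) * (J x (C m) / μ (C m)) - μ x|
  set S : (Fin M → A) → ℝ := fun C =>
    prodExp (fun (_ : Fin b) (_ : Fin M) => 1 / (M : ℝ)) fun m => g fun k => C (m k)
  have hT : prodExp (fun _ : Fin M => μ) T ≤ η₁ := (soft_covering hM hμ hμ1 hJ hJ1 hK).trans hη₁
  have hS : prodExp (fun _ : Fin M => μ) S ≤ E + G * ((b : ℝ) ^ 2 / M) :=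
    prodExp_uniform_batch_le hM hμ0 hμ1 hg0 hG hE
  have hdist : prodExp (fun _ : Fin M => μ)
      (fun C => ∑ m, 1 / (M : ℝ) * ∑ x, J x (C m) / μ (C m) * D x (C m)) =
      ∑ x, ∑ y, J x y * D x y := by
    rw [prodExp_sum]
    have h1 : ∀ m : Fin M, prodExp (fun _ : Fin M => μ)
        (fun C => 1 / (M : ℝ) * ∑ x, J x (C m) / μ (C m) * D x (C m)) =
        1 / M * ∑ x, ∑ y, J x y * D x y := fun m => by
      rw [prodExp_const_mul, prodExp_coord (fun _ => hμ1) m (fun y => ∑ x, J x y / μ y * D x y),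
        Finset.sum_comm (f := fun x y => J x y * D x y)]
      congr 1
      refine Finset.sum_congr rfl fun y _ => ?_
      rw [Finset.mul_sum]
      refine Finset.sum_congr rfl fun x _ => ?_
      have := (hμ y).ne'
      field_simp
    simp only [h1]
    rw [← Finset.sum_mul, hU, one_mul]
  -- One codebook must serve both distortion and score, so a weighted sum is averaged. The factor `G
  -- * b` is the price, over a batch, of replacing uniform messages by the actual ones.
  obtain ⟨C, hC⟩ := exists_le_of_prodExp_le (w := fun _ : Fin M => μ) (fun _ => hμ0)
    (fun _ => hμ1) (f := fun C => (∑ m, 1 / (M : ℝ) * ∑ x, J x (C m) / μ (C m) * D x (C m)) +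
      (Dm * T C + (c * S C + (c * (G * b)) * (η₂ + T C))))
    (c := (∑ x, ∑ y, J x y * D x y) + (Dm * η₁ +
        (c * (E + G * ((b : ℝ) ^ 2 / M)) + (c * (G * b)) * (η₂ + η₁)))) (by
      rw [prodExp_add, prodExp_add, prodExp_add, prodExp_const_mul, prodExp_const_mul,
        prodExp_const_mul, prodExp_add, prodExp_const fun _ => hμ1, hdist]
      gcongr)
  obtain ⟨f, hf⟩ := exists_encoder hM hμ hμ1 hJ hJ2 hD0 hDm hθ (c := c * (G * b))
    (by positivity) C
  refine ⟨C, f, ?_⟩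
  set P : Fin M → ℝ := fun m => ∑ x, if f x = m then μ x else 0 with hP
  have hP0 : ∀ m, 0 ≤ P m := fun m => Finset.sum_nonneg fun x _ => by
    split_ifs
    exacts [hμ0 x, le_rfl]
  have hP1 : ∑ m, P m = 1 := by
    simp only [hP]
    rw [Finset.sum_comm]
    simpa using hμ1
  have hscore : prodExp (fun _ : Fin b => μ) (fun x => g fun k => C (f (x k))) ≤
      S C + G * (b * ∑ m, |P m - 1 / (M : ℝ)|) := by
    rw [prodExp_comp (fun _ : Fin b => μ) f (fun m => g fun k => C (m k))]
    have h1 := sum_abs_prod_sub_prod_le hP0 hP1 (fun _ => by positivity) hU b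
    have h2 : prodExp (fun _ : Fin b => P) (fun m => g fun k => C (m k)) - S C ≤
        G * ∑ z : Fin b → Fin M, |∏ k, P (z k) - ∏ _k : Fin b, 1 / (M : ℝ)| := by
      simp only [S, prodExp]
      rw [← Finset.sum_sub_distrib, Finset.mul_sum]
      refine Finset.sum_le_sum fun z _ => ?_
      rw [← sub_mul, mul_comm G]
      exact (mul_le_mul_of_nonneg_right (le_abs_self _) (hg0 _)).trans
        (mul_le_mul_of_nonneg_left (hG _) (abs_nonneg _))
    have h3 := mul_le_mul_of_nonneg_left h1 hG0
    change prodExp (fun _ : Fin b => P) (fun m => g fun k => C (m k)) ≤ _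
    linarith
  have h4 := mul_le_mul_of_nonneg_left hscore hc
  have h5 : (c * (G * b)) * (2 * (∑ x, if θ < μ x then μ x else 0) + √(M * θ) + T C) ≤
      (c * (G * b)) * (η₂ + T C) := by gcongr
  simp only [T] at *
  nlinarith

end oneShot

/-! ### Exponential estimates -/

/-- Gibbs' inequality. -/
lemma sum_mul_logb_div_nonneg {Z : Type*} [Fintype Z] {a b : Z → ℝ} (ha : ∀ z, 0 ≤ a z)
    (hb : ∀ z, 0 ≤ b z) (hab : ∀ z, 0 < a z → 0 < b z) (h : ∑ z, b z ≤ ∑ z, a z) :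
    0 ≤ ∑ z, a z * Real.logb 2 (a z / b z) := by
  have h2 : (0 : ℝ) < Real.log 2 := Real.log_pos (by norm_num)
  have h1 : ∀ z, (a z - b z) / Real.log 2 ≤ a z * Real.logb 2 (a z / b z) := by
    intro z
    rcases (ha z).eq_or_lt with h0 | h0
    · rw [← h0]
      simp only [zero_sub, zero_mul]
      exact div_nonpos_of_nonpos_of_nonneg (by linarith [hb z]) h2.le
    · have hbz := hab z h0
      rw [Real.logb, ← mul_div_assoc]
      refine div_le_div_of_nonneg_right ?_ h2.le
      have h3 := Real.log_le_sub_one_of_pos (div_pos hbz h0)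
      have h4 : Real.log (a z / b z) = - Real.log (b z / a z) := by
        rw [← Real.log_inv, inv_div]
      rw [h4]
      have h5 := mul_le_mul_of_nonneg_left h3 h0.le
      have h6 : a z * (b z / a z - 1) = b z - a z := by field_simp
      linarith
  calc (0 : ℝ) ≤ (∑ z, a z - ∑ z, b z) / Real.log 2 := div_nonneg (by linarith) h2.le
    _ = ∑ z, (a z - b z) / Real.log 2 := by rw [← Finset.sum_sub_distrib, Finset.sum_div]
    _ ≤ _ := Finset.sum_le_sum fun z _ => h1 z

lemma mutualInfo_nonneg {X : Type*} [Fintype X] {p : X → ℝ} (hp : p ∈ stdSimplex ℝ X)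
    {W : X → X → ℝ} (hW : ∀ x, W x ∈ stdSimplex ℝ X) : 0 ≤ mutualInfo p W := by
  have h := sum_mul_logb_div_nonneg (Z := X × X) (a := fun z => p z.1 * W z.1 z.2)
    (b := fun z => p z.1 * ∑ x', p x' * W x' z.2)
    (fun z => mul_nonneg (hp.1 _) ((hW _).1 _))
    (fun z => mul_nonneg (hp.1 _) (Finset.sum_nonneg fun x _ => mul_nonneg (hp.1 _) ((hW _).1 _)))
    (fun z hz => by
      have h1 : 0 < p z.1 := (hp.1 z.1).lt_of_ne (fun h => by simp [← h] at hz)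
      refine mul_pos h1 (lt_of_lt_of_le hz ?_)
      exact Finset.single_le_sum (f := fun x => p x * W x z.2)
        (fun x _ => mul_nonneg (hp.1 x) ((hW x).1 z.2)) (Finset.mem_univ z.1))
    (by
      rw [Fintype.sum_prod_type, Fintype.sum_prod_type]
      have h1 : ∑ y, ∑ x', p x' * W x' y = 1 := by
        rw [Finset.sum_comm]
        simp only [← Finset.mul_sum, (hW _).2, mul_one, hp.2]
      simp only [← Finset.mul_sum, (hW _).2, h1, le_refl])
  rw [Fintype.sum_prod_type] at h
  exact h

/-- Chernoff's bound for bounded variables with negative mean. -/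
lemma exists_chernoff {Z : Type*} [Fintype Z] {P : Z → ℝ} (hP0 : ∀ z, 0 ≤ P z)
    (hP1 : ∑ z, P z = 1) (ζ : Z → ℝ) (hζ : ∑ z, P z * ζ z < 0) :
    ∃ ρ : ℝ, 0 ≤ ρ ∧ ρ < 1 ∧ ∀ n : ℕ,
      ∑ z : Fin n → Z, (if 0 < ∑ t, ζ (z t) then ∏ t, P (z t) else 0) ≤ ρ ^ n := by
  set K : ℝ := 1 + ∑ z, |ζ z| with hK
  have hKs : ∀ z, |ζ z| ≤ K := fun z => by
    have := Finset.single_le_sum (fun z _ => abs_nonneg (ζ z)) (Finset.mem_univ z)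
    linarith
  have hK1 : 1 ≤ K := by
    have := Finset.sum_nonneg (fun z (_ : z ∈ Finset.univ) => abs_nonneg (ζ z))
    linarith
  set e : ℝ := -∑ z, P z * ζ z with he
  have he0 : 0 < e := by linarith
  -- The first bound on `s` permits the second-order estimate of `exp`; the second makes the
  -- quadratic error `s² K²` smaller than the linear gain `s * e`.
  obtain ⟨s, hs0, hs1, hs2⟩ : ∃ s : ℝ, 0 < s ∧ s * K ≤ 1 ∧ s * K ^ 2 < e := by
    refine ⟨min (1 / K) (e / (2 * K ^ 2)), by positivity, ?_, ?_⟩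
    · calc _ ≤ 1 / K * K := by gcongr; exact min_le_left _ _
        _ = 1 := by field_simp
    · calc _ ≤ e / (2 * K ^ 2) * K ^ 2 := by gcongr; exact min_le_right _ _
        _ = e / 2 := by field_simp
        _ < e := by linarith
  refine ⟨∑ z, P z * Real.exp (s * ζ z), Finset.sum_nonneg fun z _ =>
    mul_nonneg (hP0 z) (Real.exp_pos _).le, ?_, fun n => ?_⟩
  · have h1 : ∀ z, P z * Real.exp (s * ζ z) ≤ P z * (1 + s ^ 2 * K ^ 2) + s * (P z * ζ z) := by
      intro z
      have h2 : |s * ζ z| ≤ s * K := by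
        rw [abs_mul, abs_of_pos hs0]
        exact mul_le_mul_of_nonneg_left (hKs z) hs0.le
      have h3 := Real.abs_exp_sub_one_sub_id_le (h2.trans hs1)
      have h4 : (s * ζ z) ^ 2 ≤ s ^ 2 * K ^ 2 := by
        rw [← mul_pow, ← sq_abs]
        exact pow_le_pow_left₀ (abs_nonneg _) h2 2
      have h5 := (abs_le.1 h3).2
      have h6 := mul_le_mul_of_nonneg_left
        (show Real.exp (s * ζ z) ≤ 1 + s ^ 2 * K ^ 2 + s * ζ z by linarith) (hP0 z)
      linarith
    refine (Finset.sum_le_sum fun z _ => h1 z).trans_lt ?_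
    rw [Finset.sum_add_distrib, ← Finset.sum_mul, ← Finset.mul_sum, hP1]
    nlinarith
  · have h1 := prodExp_prod (fun _ : Fin n => P) (fun _ z => Real.exp (s * ζ z))
    simp only [Finset.prod_const, Finset.card_univ, Fintype.card_fin] at h1
    rw [← h1]
    refine Finset.sum_le_sum fun z _ => ?_
    have h0 : 0 ≤ ∏ t, P (z t) := Finset.prod_nonneg fun t _ => hP0 _
    beta_reduce
    rw [← Real.exp_sum, ← Finset.mul_sum]
    split_ifs with h
    · exact le_mul_of_one_le_right h0 (Real.one_le_exp (by positivity))
    · positivity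

/-! ### Large deviations for i.i.d. words -/

section words

variable {X : Type*} [Fintype X]

lemma sum_iid {p : X → ℝ} (hp : ∑ x, p x = 1) (n : ℕ) : ∑ x : Fin n → X, iid p n x = 1 := by
  have := prodExp_const (w := fun _ : Fin n => p) (fun _ => hp) 1
  simpa [prodExp, iid] using this

lemma sum_words_prod (n : ℕ) (f : (Fin n → X) → (Fin n → X) → ℝ) :
    ∑ x, ∑ y, f x y = ∑ z : Fin n → X × X, f (fun t => (z t).1) (fun t => (z t).2) := by
  rw [← Fintype.sum_prod_type', ← (Equiv.arrowProdEquivProdArrow (Fin n) (fun _ => X)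
    (fun _ => X)).sum_comp]
  rfl

lemma sum_prod_fst {P : X → X → ℝ} {p : X → ℝ} (h : ∀ x, ∑ y, P x y = p x) (n : ℕ)
    (x : Fin n → X) : ∑ y : Fin n → X, ∏ t, P (x t) (y t) = iid p n x := by
  classical
  simp only [iid, ← h]
  rw [Finset.prod_univ_sum, Fintype.piFinset_univ]

lemma sum_prod_dist {P : X → X → ℝ} (hP : ∑ x, ∑ y, P x y = 1) (d : X → X → ℝ) {n : ℕ}
    (hn : 1 ≤ n) :
    ∑ x : Fin n → X, ∑ y : Fin n → X, (∏ t, P (x t) (y t)) * (1 / (n : ℝ) * ∑ t, d (x t) (y t)) =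
      ∑ x, ∑ y, P x y * d x y := by
  rw [sum_words_prod]
  have hn' : (0 : ℝ) < n := by exact_mod_cast hn
  have hP' : ∀ _ : Fin n, ∑ z : X × X, P z.1 z.2 = 1 := fun _ => by
    rw [Fintype.sum_prod_type]; exact hP
  change prodExp (fun (_ : Fin n) (z : X × X) => P z.1 z.2)
    (fun z => 1 / (n : ℝ) * ∑ t, d (z t).1 (z t).2) = _
  rw [prodExp_const_mul, prodExp_sum]
  have h1 : ∀ t : Fin n, prodExp (fun (_ : Fin n) (z : X × X) => P z.1 z.2)
      (fun z => d (z t).1 (z t).2) = ∑ x, ∑ y, P x y * d x y := fun t => by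
    rw [prodExp_coord hP' t (fun z => d z.1 z.2), Fintype.sum_prod_type]
  simp only [h1, Finset.sum_const, Finset.card_univ, Fintype.card_fin, nsmul_eq_mul]
  field_simp

/-- Large deviations of the information density. -/
lemma exists_infoDensity_tail {p : X → ℝ} (hp : p ∈ stdSimplex ℝ X) (hpos : ∀ x, 0 < p x)
    {d : X → X → ℝ} {Δ : ℝ} {W : X → X → ℝ} (hW : W ∈ feasible p d Δ) {γ : ℝ} (hγ : 0 < γ) :
    ∃ ρ : ℝ, 0 ≤ ρ ∧ ρ < 1 ∧ ∀ n : ℕ, (∑ x : Fin n → X, ∑ y : Fin n → X,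
      if (2 : ℝ) ^ ((n : ℝ) * (mutualInfo p W + γ)) * (iid p n x * iid p n y) <
        ∏ t, p (x t) * W (x t) (y t) then ∏ t, p (x t) * W (x t) (y t) else 0) ≤ ρ ^ n := by
  set P : X × X → ℝ := fun z => p z.1 * W z.1 z.2 with hPdef
  have hP0 : ∀ z, 0 ≤ P z := fun z => mul_nonneg (hp.1 _) ((hW.1 _).1 _)
  have hP1 : ∑ z, P z = 1 := by
    rw [Fintype.sum_prod_type]
    simp only [hPdef, ← Finset.mul_sum, (hW.1 _).2, mul_one, hp.2]
  -- Centred information density, with mean `-γ`. On words of positive probability the event in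
  -- question is that its sum is positive.
  set ζ : X × X → ℝ := fun z => Real.logb 2 (P z / (p z.1 * p z.2)) - (mutualInfo p W + γ) with hζ
  have hmean : ∑ z, P z * ζ z < 0 := by
    have : ∑ z, P z * ζ z = -γ := by
      simp only [hζ, mul_sub, Finset.sum_sub_distrib, ← Finset.sum_mul, hP1]
      have h1 : ∑ z, P z * Real.logb 2 (P z / (p z.1 * p z.2)) = mutualInfo p W := by
        rw [Fintype.sum_prod_type, mutualInfo]
        simp only [hW.2.1, hPdef]
      rw [h1]; ring
    rw [this]; linarith
  obtain ⟨ρ, h0, h1, h⟩ := exists_chernoff hP0 hP1 ζ hmean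
  refine ⟨ρ, h0, h1, fun n => le_trans ?_ (h n)⟩
  rw [sum_words_prod]
  refine Finset.sum_le_sum fun z _ => ?_
  have hpr : 0 ≤ ∏ t, P (z t) := Finset.prod_nonneg fun t _ => hP0 _
  change (if _ < ∏ t, P (z t) then ∏ t, P (z t) else 0) ≤ _
  split_ifs with ha hb hb
  · exact le_rfl
  · exfalso
    have hq : ∀ t, 0 < p (z t).1 * p (z t).2 := fun t => mul_pos (hpos _) (hpos _)
    have hqq : iid p n (fun t => (z t).1) * iid p n (fun t => (z t).2) =
        ∏ t, p (z t).1 * p (z t).2 := by simp only [iid, Finset.prod_mul_distrib]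
    rw [hqq] at ha
    have hq0 : 0 < ∏ t, p (z t).1 * p (z t).2 := Finset.prod_pos fun t _ => hq t
    have hPpos : 0 < ∏ t, P (z t) := lt_of_le_of_lt (by positivity) ha
    have hPt : ∀ t, 0 < P (z t) := fun t => (hP0 _).lt_of_ne fun h =>
      hPpos.ne' (Finset.prod_eq_zero (Finset.mem_univ t) h.symm)
    have hlog := Real.logb_lt_logb (b := 2) (by norm_num) (by positivity) ((lt_div_iff₀ hq0).2 ha)
    rw [Real.logb_rpow (by norm_num) (by norm_num), ← Finset.prod_div_distrib, Real.logb_prod]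
      at hlog
    · refine hb ?_
      simp only [hζ, Finset.sum_sub_distrib, Finset.sum_const, Finset.card_univ, Fintype.card_fin,
        nsmul_eq_mul]
      linarith
    · intro t _
      exact (div_pos (hPt t) (hq t)).ne'
  · exact hpr
  · exact le_rfl

/-- Large deviations of the probability of a word. -/
lemma exists_iid_tail {p : X → ℝ} (hp : p ∈ stdSimplex ℝ X) (hpos : ∀ x, 0 < p x)
    {γ : ℝ} (hγ : 0 < γ) :
    ∃ ρ : ℝ, 0 ≤ ρ ∧ ρ < 1 ∧ ∀ n : ℕ, (∑ x : Fin n → X,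
      if (2 : ℝ) ^ (-((n : ℝ) * (entropy p - γ))) < iid p n x then iid p n x else 0) ≤ ρ ^ n := by
  set ζ : X → ℝ := fun x => Real.logb 2 (p x) + (entropy p - γ) with hζ
  have hmean : ∑ x, p x * ζ x < 0 := by
    have : ∑ x, p x * ζ x = -γ := by
      simp only [hζ, mul_add, Finset.sum_add_distrib, ← Finset.sum_mul, hp.2, entropy]
      ring
    rw [this]; linarith
  obtain ⟨ρ, h0, h1, h⟩ := exists_chernoff hp.1 hp.2 ζ hmean
  refine ⟨ρ, h0, h1, fun n => le_trans ?_ (h n)⟩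
  refine Finset.sum_le_sum fun x _ => ?_
  have hpr : 0 < ∏ t, p (x t) := Finset.prod_pos fun t _ => hpos _
  change (if _ < ∏ t, p (x t) then ∏ t, p (x t) else 0) ≤ _
  split_ifs with ha hb hb
  · exact le_rfl
  · exfalso
    have hlog := Real.logb_lt_logb (b := 2) (by norm_num) (by positivity) ha
    rw [Real.logb_rpow (by norm_num) (by norm_num), Real.logb_prod] at hlog
    · refine hb ?_
      simp only [hζ, Finset.sum_add_distrib, Finset.sum_const, Finset.card_univ, Fintype.card_fin,
        nsmul_eq_mul]
      linarith
    · intro t _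
      exact (hpos _).ne'
  · exact hpr.le
  · exact le_rfl

end words

/-! ### Choice of rates and asymptotics of random coding -/

lemma size_pos {n : ℕ} {R : ℝ} (hR : 0 ≤ R) : 0 < size n R :=
  Nat.floor_pos.2 (Real.one_le_rpow (by norm_num) (by positivity))

lemma size_le (n : ℕ) (R : ℝ) : (size n R : ℝ) ≤ (2 : ℝ) ^ ((n : ℝ) * R) :=
  Nat.floor_le (by positivity)

lemma rpow_le_two_mul_size {n : ℕ} {R : ℝ} (hR : 0 ≤ R) :
    (2 : ℝ) ^ ((n : ℝ) * R) ≤ 2 * size n R := by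
  have h1 : (1 : ℝ) ≤ size n R := by exact_mod_cast size_pos hR
  have h2 := Nat.lt_floor_add_one ((2 : ℝ) ^ ((n : ℝ) * R))
  change _ < (size n R : ℝ) + 1 at h2
  linarith

lemma size_mono (n : ℕ) {R R' : ℝ} (h : R ≤ R') : size n R ≤ size n R' :=
  Nat.floor_le_floor (Real.rpow_le_rpow_of_exponent_le (by norm_num) (by gcongr))

/-- The error terms of the random coding argument decay exponentially. -/
lemma exists_exponential_bounds {X : Type*} [Fintype X] {p : X → ℝ} (hp : p ∈ stdSimplex ℝ X)
    (hpos : ∀ x, 0 < p x) {d : X → X → ℝ} {Δ : ℝ} {W : X → X → ℝ} (hW : W ∈ feasible p d Δ)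
    (hH : mutualInfo p W < entropy p) {ε : ℝ} (hε : 0 < ε) :
    ∃ (ρ : ℝ) (M : ℕ → ℕ) (K θ : ℕ → ℝ), 0 < ρ ∧ ρ < 1 ∧ ∀ n : ℕ, 0 < M n ∧
      M n ≤ size n (mutualInfo p W + ε) ∧ 0 ≤ K n ∧ 0 ≤ θ n ∧ 1 / (M n : ℝ) ≤ 4 * ρ ^ n ∧
      2 * (∑ x : Fin n → X, ∑ y : Fin n → X, if K n * (iid p n x * iid p n y) <
        ∏ t, p (x t) * W (x t) (y t) then ∏ t, p (x t) * W (x t) (y t) else 0) + √(K n / M n) ≤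
        4 * ρ ^ n ∧
      2 * (∑ x : Fin n → X, if θ n < iid p n x then iid p n x else 0) + √(M n * θ n) ≤
        4 * ρ ^ n := by
  set I := mutualInfo p W with hI
  have hI0 : 0 ≤ I := mutualInfo_nonneg hp hW.1
  -- The exponents will be `I + γ` for `K`, `I + 2γ` for `M` and `-(H - γ)` for `θ`. Then `K / M`
  -- and `M * θ` are `O(2^{-nγ})`, the latter because `I + 3γ - H ≤ -γ`; the square roots decay like
  -- `r ^ n` below.
  obtain ⟨γ, hγ, hγ1, hγ2⟩ : ∃ γ : ℝ, 0 < γ ∧ I + 4 * γ ≤ entropy p ∧ 4 * γ ≤ ε := by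
    refine ⟨min (entropy p - I) ε / 4, ?_, ?_, ?_⟩
    · have := lt_min (sub_pos.2 hH) hε
      linarith
    · linarith [min_le_left (entropy p - I) ε]
    · linarith [min_le_right (entropy p - I) ε]
  obtain ⟨ρ₁, h10, h11, h1⟩ := exists_infoDensity_tail hp hpos hW hγ
  obtain ⟨ρ₂, h20, h21, h2⟩ := exists_iid_tail hp hpos hγ
  set r : ℝ := (2 : ℝ) ^ (-(γ / 2)) with hr
  have hr0 : 0 < r := by positivity
  have hr1 : r < 1 := Real.rpow_lt_one_of_one_lt_of_neg (by norm_num) (by linarith)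
  have hrn : ∀ n : ℕ, (r ^ n) ^ 2 = (2 : ℝ) ^ (-((n : ℝ) * γ)) := fun n => by
    rw [← pow_mul, hr, ← Real.rpow_natCast, ← Real.rpow_mul (by norm_num)]
    push_cast
    congr 1
    ring
  set ρ := max r (max ρ₁ ρ₂)
  have hρr : ∀ n : ℕ, r ^ n ≤ ρ ^ n := fun n => pow_le_pow_left₀ hr0.le (le_max_left _ _) n
  have hρ1 : ∀ n : ℕ, ρ₁ ^ n ≤ ρ ^ n := fun n =>
    pow_le_pow_left₀ h10 ((le_max_left _ _).trans (le_max_right _ _)) n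
  have hρ2 : ∀ n : ℕ, ρ₂ ^ n ≤ ρ ^ n := fun n =>
    pow_le_pow_left₀ h20 ((le_max_right _ _).trans (le_max_right _ _)) n
  refine ⟨ρ, fun n => size n (I + 2 * γ), fun n => (2 : ℝ) ^ ((n : ℝ) * (I + γ)),
    fun n => (2 : ℝ) ^ (-((n : ℝ) * (entropy p - γ))), lt_max_of_lt_left hr0,
    max_lt hr1 (max_lt h11 h21), fun n => ?_⟩
  have hMpos : 0 < size n (I + 2 * γ) := size_pos (by positivity)
  have hMpos' : (0 : ℝ) < size n (I + 2 * γ) := by exact_mod_cast hMpos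
  have hMlow := rpow_le_two_mul_size (n := n) (R := I + 2 * γ) (by positivity)
  have hMup := size_le n (I + 2 * γ)
  have hrn1 : r ^ n ≤ 1 := pow_le_one₀ hr0.le hr1.le
  have hrn0 : 0 < r ^ n := by positivity
  have hKM : (2 : ℝ) ^ ((n : ℝ) * (I + γ)) / size n (I + 2 * γ) ≤ (2 * r ^ n) ^ 2 := by
    rw [div_le_iff₀ hMpos', mul_pow, hrn]
    have : (2 : ℝ) ^ ((n : ℝ) * (I + γ)) =
        (2 : ℝ) ^ (-((n : ℝ) * γ)) * (2 : ℝ) ^ ((n : ℝ) * (I + 2 * γ)) := by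
      rw [← Real.rpow_add (by norm_num)]; congr 1; ring
    rw [this]
    have h3 : (0 : ℝ) < (2 : ℝ) ^ (-((n : ℝ) * γ)) := by positivity
    nlinarith [mul_le_mul_of_nonneg_left hMlow h3.le, mul_pos h3 hMpos']
  have hMθ : (size n (I + 2 * γ) : ℝ) * (2 : ℝ) ^ (-((n : ℝ) * (entropy p - γ))) ≤
      (2 * r ^ n) ^ 2 := by
    calc _ ≤ (2 : ℝ) ^ ((n : ℝ) * (I + 2 * γ)) * (2 : ℝ) ^ (-((n : ℝ) * (entropy p - γ))) := by
          gcongr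
      _ ≤ (2 : ℝ) ^ (-((n : ℝ) * γ)) := by
          rw [← Real.rpow_add (by norm_num)]
          refine Real.rpow_le_rpow_of_exponent_le (by norm_num) ?_
          have : (0 : ℝ) ≤ n := by positivity
          nlinarith
      _ ≤ _ := by rw [mul_pow, hrn]; nlinarith [Real.rpow_pos_of_pos two_pos (-((n : ℝ) * γ))]
  refine ⟨hMpos, size_mono n (by linarith), by positivity, by positivity, ?_, ?_, ?_⟩
  · have h3 : 1 / (size n (I + 2 * γ) : ℝ) ≤ (2 * r ^ n) ^ 2 := by
      refine le_trans ?_ hKM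
      gcongr
      exact Real.one_le_rpow (by norm_num) (by positivity)
    have h4 : (2 * r ^ n) ^ 2 ≤ 4 * r ^ n := by nlinarith
    linarith [hρr n]
  · have h3 := Real.sqrt_le_sqrt hKM
    rw [Real.sqrt_sq (by positivity)] at h3
    linarith [hρr n, hρ1 n, h1 n]
  · have h3 := Real.sqrt_le_sqrt hMθ
    rw [Real.sqrt_sq (by positivity)] at h3
    linarith [hρr n, hρ2 n, h2 n]

/-- Subexponential factors are absorbed by exponential decay. -/
lemma tendsto_subexponential {B : ℕ → ℕ} (hB : ∀ n, 1 ≤ n → 1 ≤ B n)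
    (hBlim : Tendsto (fun n : ℕ => Real.logb 2 (B n) / (n : ℝ)) atTop (𝓝 0)) {ρ : ℝ} (h0 : 0 < ρ)
    (h1 : ρ < 1) (L : ℝ) (hL : 0 ≤ L) :
    Tendsto (fun n : ℕ => (1 + n * L) * (B n : ℝ) ^ 3 * ρ ^ n) atTop (𝓝 0) := by
  -- Split `ρ ^ n` into two equal powers: one factor `(√ρ) ^ n` absorbs `B n ^ 3`, the other the
  -- linear term.
  have hs0 : 0 < √ρ := Real.sqrt_pos.2 h0
  have hs1 : √ρ < 1 := by
    rw [Real.sqrt_lt' one_pos]; simpa using h1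
  have hlim : Tendsto (fun n : ℕ => (√ρ) ^ n + L * (n * (√ρ) ^ n)) atTop (𝓝 0) := by
    have h2 := tendsto_pow_atTop_nhds_zero_of_lt_one hs0.le hs1
    have h3 := (tendsto_self_mul_const_pow_of_lt_one hs0.le hs1).const_mul L
    simpa using h2.add h3
  have hlog : Real.logb 2 (√ρ) < 0 := Real.logb_neg (by norm_num) hs0 hs1
  have hev := hBlim.eventually (gt_mem_nhds (show (0 : ℝ) < -Real.logb 2 (√ρ) / 3 by linarith))
  refine squeeze_zero' (Eventually.of_forall fun n => by positivity) ?_ hlim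
  filter_upwards [hev, eventually_ge_atTop 1] with n hn hn1
  have hn0 : (0 : ℝ) < n := by exact_mod_cast hn1
  have hBpos : (0 : ℝ) < B n := by exact_mod_cast hB n hn1
  rw [div_lt_iff₀ hn0] at hn
  have h2 : (B n : ℝ) ^ 3 * (√ρ) ^ n ≤ 1 := by
    rw [← Real.logb_nonpos_iff (b := 2) (by norm_num) (by positivity),
      Real.logb_mul (by positivity) (by positivity), Real.logb_pow, Real.logb_pow]
    push_cast
    linarith
  have h3 : ρ ^ n = (√ρ) ^ n * (√ρ) ^ n := by
    rw [← mul_pow, Real.mul_self_sqrt h0.le]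
  rw [h3]
  have h4 : 0 ≤ (1 + n * L) * (√ρ) ^ n := by positivity
  nlinarith [mul_le_mul_of_nonneg_left h2 h4]

/-- Good deterministic codes for a sequence of nonnegative batch scores. -/
theorem eventually_exists_code {X : Type*} [Fintype X] {p : X → ℝ} (hp : p ∈ stdSimplex ℝ X)
    (hpos : ∀ x, 0 < p x) {d : X → X → ℝ} (hd : ∀ x y, 0 ≤ d x y) {B : ℕ → ℕ}
    (hB : ∀ n, 1 ≤ n → 1 ≤ B n)
    (hBlim : Tendsto (fun n : ℕ => Real.logb 2 (B n) / (n : ℝ)) atTop (𝓝 0))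
    {Δ : ℝ} {W : X → X → ℝ} (hW : W ∈ feasible p d Δ) (hH : mutualInfo p W < entropy p)
    {g : ∀ n, (Fin (B n) → Fin n → X) → ℝ} (hg0 : ∀ n z, 0 ≤ g n z) {L E : ℝ} (hL : 0 ≤ L)
    (hE0 : 0 ≤ E) (hG : ∀ n z, g n z ≤ 1 + (n * B n : ℕ) * L)
    (hE : ∀ n, 1 ≤ n → prodExp (fun _ => iid p n) (g n) ≤ E) {ε : ℝ} (hε : 0 < ε) :
    ∃ C : ℝ, ∀ᶠ n in atTop, ∃ (y : Fin (size n (mutualInfo p W + ε)) → Fin n → X)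
      (f : (Fin n → X) → Fin (size n (mutualInfo p W + ε))),
      ∑ x, iid p n x * (1 / (n : ℝ) * ∑ t, d (x t) (y (f x) t)) ≤ Δ + ε ∧
      prodExp (fun _ => iid p n) (fun x => g n fun k => y (f (x k))) ≤ C := by
  obtain ⟨ρ, M, K, θ, hρ0, hρ1, hMKθ⟩ := exists_exponential_bounds hp hpos hW hH hε
  set Dm := ∑ x, ∑ y, d x y with hDm
  have hDm0 : 0 ≤ Dm := Finset.sum_nonneg fun x _ => Finset.sum_nonneg fun y _ => hd x y
  have hdle : ∀ x y, d x y ≤ Dm := fun x y =>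
    (Finset.single_le_sum (f := fun y => d x y) (fun y _ => hd x y) (Finset.mem_univ y)).trans
      (Finset.single_le_sum (f := fun x => ∑ y, d x y)
        (fun x _ => Finset.sum_nonneg fun y _ => hd x y) (Finset.mem_univ x))
  -- With this weight, the score contribution `c * (E + 1)` costs only `ε / 2` of distortion, while
  -- the score stays below `(Δ + ε) / c`, independent of `n`.
  set c := ε / (2 * (E + 1)) with hc
  have hc0 : 0 < c := by positivity
  have hcE : c * (E + 1) = ε / 2 := by rw [hc]; field_simp
  have hlim1 : ∀ᶠ n : ℕ in atTop, Dm * (4 * ρ ^ n) < ε / 2 := by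
    have h := ((tendsto_pow_atTop_nhds_zero_of_lt_one hρ0.le hρ1).const_mul 4).const_mul Dm
    simp only [mul_zero] at h
    exact h.eventually (gt_mem_nhds (by positivity))
  have hlim2 : ∀ᶠ n : ℕ in atTop, 12 * ((1 + n * L) * (B n : ℝ) ^ 3 * ρ ^ n) < 1 := by
    have h := (tendsto_subexponential hB hBlim hρ0 hρ1 L hL).const_mul 12
    simp only [mul_zero] at h
    exact h.eventually (gt_mem_nhds (by positivity))
  refine ⟨(Δ + ε) / c, ?_⟩
  filter_upwards [hlim1, hlim2, eventually_ge_atTop 1] with n hn1 hn2 hn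
  obtain ⟨hM, hMle, hK, hθ, hM1, hη₁, hη₂⟩ := hMKθ n
  have hn0 : (0 : ℝ) < n := by exact_mod_cast hn
  have hb : (1 : ℝ) ≤ B n := by exact_mod_cast hB n hn
  have hiid : ∀ x, 0 < iid p n x := fun x => Finset.prod_pos fun t _ => hpos _
  obtain ⟨C, f, hf⟩ := exists_oneShot_code (A := Fin n → X) hM hiid (sum_iid hp.2 n)
    (J := fun x y => ∏ t, p (x t) * W (x t) (y t))
    (fun x y => Finset.prod_nonneg fun t _ => mul_nonneg (hp.1 _) ((hW.1 _).1 _))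
    (fun x => sum_prod_fst (P := fun x y => p x * W x y)
      (fun x => by rw [← Finset.mul_sum, (hW.1 x).2, mul_one]) n x)
    (fun y => sum_prod_fst (P := fun y x => p x * W x y) hW.2.1 n y)
    (D := fun x y => 1 / (n : ℝ) * ∑ t, d (x t) (y t)) (Dm := Dm)
    (fun x y => mul_nonneg (by positivity) (Finset.sum_nonneg fun t _ => hd _ _)) hDm0
    (fun x y => by
      have h1 : ∑ t, d (x t) (y t) ≤ ∑ _t : Fin n, Dm := Finset.sum_le_sum fun t _ => hdle _ _
      rw [Finset.sum_const, Finset.card_univ, Fintype.card_fin, nsmul_eq_mul] at h1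
      rw [one_div_mul_eq_div, div_le_iff₀ hn0]
      linarith)
    (hg0 n) (by positivity) (hG n) (hE n hn) hK hθ hc0.le hη₁ hη₂
  rw [sum_prod_dist (P := fun x y => p x * W x y) (by
    simp only [← Finset.mul_sum, (hW.1 _).2, mul_one, hp.2]) d hn] at hf
  have hcast : ∀ x, 0 ≤ 1 / (n : ℝ) * ∑ t, d (x t) (C (f x) t) := fun x =>
    mul_nonneg (by positivity) (Finset.sum_nonneg fun t _ => hd _ _)
  have hdist0 : 0 ≤ ∑ x, iid p n x * (1 / (n : ℝ) * ∑ t, d (x t) (C (f x) t)) :=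
    Finset.sum_nonneg fun x _ => mul_nonneg (hiid x).le (hcast x)
  have hscore0 : 0 ≤ prodExp (fun _ => iid p n) (fun x => g n fun k => C (f (x k))) :=
    Finset.sum_nonneg fun x _ => mul_nonneg (Finset.prod_nonneg fun k _ => (hiid _).le) (hg0 n _)
  -- Collisions and message non-uniformity together. The cube of `B n` comes from one factor in the
  -- maximal score and two in the collision bound.
  have hsmall : (1 + ((n * B n : ℕ) : ℝ) * L) * ((B n : ℝ) ^ 2 / M n) +
      (1 + ((n * B n : ℕ) : ℝ) * L) * (B n * (4 * ρ ^ n + 4 * ρ ^ n)) ≤ 1 := by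
    push_cast
    have hρn : 0 < ρ ^ n := by positivity
    have hbb : (B n : ℝ) ≤ (B n : ℝ) ^ 2 := by nlinarith
    have h1 : 1 + (n : ℝ) * B n * L ≤ B n * (1 + n * L) := by
      nlinarith
    have h2 : (B n : ℝ) ^ 2 / M n + B n * (4 * ρ ^ n + 4 * ρ ^ n) ≤ (B n : ℝ) ^ 2 * (12 * ρ ^ n) := by
      rw [div_eq_mul_one_div]
      have h3 := mul_le_mul_of_nonneg_left hM1 (sq_nonneg (B n : ℝ))
      have h4 := mul_le_mul_of_nonneg_right hbb (show 0 ≤ 8 * ρ ^ n by positivity)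
      linarith
    calc _ = (1 + (n : ℝ) * B n * L) * ((B n : ℝ) ^ 2 / M n + B n * (4 * ρ ^ n + 4 * ρ ^ n)) := by
          ring
      _ ≤ (B n * (1 + n * L)) * ((B n : ℝ) ^ 2 * (12 * ρ ^ n)) := by
          gcongr
      _ = 12 * ((1 + n * L) * (B n : ℝ) ^ 3 * ρ ^ n) := by ring
      _ ≤ 1 := hn2.le
  have htotal : ∑ x, iid p n x * (1 / (n : ℝ) * ∑ t, d (x t) (C (f x) t)) +
      c * prodExp (fun _ => iid p n) (fun x => g n fun k => C (f (x k))) ≤ Δ + ε := by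
    refine hf.trans ?_
    have h1 := mul_le_mul_of_nonneg_left hsmall hc0.le
    have h2 := hW.2.2
    linarith
  -- The codebook has only `M n` words; the unused messages are padded with the first codeword.
  have key : ∀ x, (fun m : Fin (size n (mutualInfo p W + ε)) =>
      if h : m.1 < M n then C ⟨m.1, h⟩ else C ⟨0, hM⟩) (Fin.castLE hMle (f x)) = C (f x) :=
    fun x => by simp
  refine ⟨fun m => if h : m.1 < M n then C ⟨m.1, h⟩ else C ⟨0, hM⟩,
    fun x => Fin.castLE hMle (f x), ?_, ?_⟩
  · simp only [key]
    nlinarith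
  · simp only [key]
    rw [le_div_iff₀ hc0]
    linarith

/-! ### Deterministic codes and achievability -/

section codes

variable {X : Type*} [Fintype X]

lemma iid_nonneg {X : Type*} {p : X → ℝ} (hp : ∀ x, 0 ≤ p x) (n : ℕ) (x : Fin n → X) : 0 ≤ iid p n x :=
  Finset.prod_nonneg fun _ _ => hp _

lemma Code.law_nonneg {n : ℕ} {R Rc : ℝ} (c : Code X n R Rc) {p : X → ℝ} (hp : ∀ x, 0 ≤ p x)
    (z : (Fin n → X) × (Fin n → X)) : 0 ≤ c.law p z :=
  Finset.sum_nonneg fun j _ => Finset.sum_nonneg fun m _ =>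
    mul_nonneg (mul_nonneg (mul_nonneg (iid_nonneg hp n _) (by positivity))
      ((c.enc_mem z.1 j).1 m)) ((c.dec_mem m j).1 z.2)

lemma Code.sum_law_snd {n : ℕ} {R Rc : ℝ} (c : Code X n R Rc) (hRc : 0 ≤ Rc) (p : X → ℝ)
    (x : Fin n → X) : ∑ y, c.law p (x, y) = iid p n x := by
  have hs : (0 : ℝ) < size n Rc := by exact_mod_cast size_pos hRc
  simp only [Code.law]
  rw [Finset.sum_comm]
  have h1 : ∀ j, ∑ y, ∑ m, iid p n x * (1 / (size n Rc : ℝ)) * c.enc x j m * c.dec m j y =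
      iid p n x * (1 / (size n Rc : ℝ)) := fun j => by
    rw [Finset.sum_comm]
    simp only [← Finset.mul_sum, (c.dec_mem _ _).2, mul_one, (c.enc_mem _ _).2]
  simp only [h1, Finset.sum_const, Finset.card_univ, Fintype.card_fin, nsmul_eq_mul]
  field_simp

lemma Code.sum_law {n : ℕ} {R Rc : ℝ} (c : Code X n R Rc) (hRc : 0 ≤ Rc) {p : X → ℝ}
    (hp : ∑ x, p x = 1) : ∑ z, c.law p z = 1 := by
  rw [Fintype.sum_prod_type]
  simp only [c.sum_law_snd hRc, sum_iid hp]

/-- The expected distortion of a batch is that of one of its words. -/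
lemma expDist_eq {n : ℕ} {R Rc : ℝ} (c : Code X n R Rc) (hRc : 0 ≤ Rc) {p : X → ℝ}
    (hp : ∑ x, p x = 1) (d : X → X → ℝ) {b : ℕ} (hb : 1 ≤ b) :
    expDist p d c b = ∑ z, c.law p z * (1 / (n : ℝ) * ∑ t, d (z.1 t) (z.2 t)) := by
  have hb' : (0 : ℝ) < b := by exact_mod_cast hb
  change prodExp (fun _ : Fin b => c.law p) (fun z => 1 / (b : ℝ) *
    ∑ k, (1 / (n : ℝ) * ∑ t, d ((z k).1 t) ((z k).2 t))) = _
  rw [prodExp_const_mul, prodExp_sum]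
  have h1 := fun k : Fin b => prodExp_coord (w := fun _ : Fin b => c.law p)
    (fun _ => c.sum_law hRc hp) k (fun z => 1 / (n : ℝ) * ∑ t, d (z.1 t) (z.2 t))
  simp only [h1, Finset.sum_const, Finset.card_univ, Fintype.card_fin, nsmul_eq_mul]
  field_simp

/-- The deterministic code with encoder `f` and codebook `y`. -/
def detCode {n : ℕ} {R : ℝ} (y : Fin (size n R) → Fin n → X)
    (f : (Fin n → X) → Fin (size n R)) : Code X n R 0 := by
  classical exact
  { enc := fun x _ m => if f x = m then 1 else 0
    enc_mem := fun x _ => ⟨fun m => by beta_reduce; split_ifs <;> norm_num, by simp⟩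
    dec := fun m _ w => if y m = w then 1 else 0
    dec_mem := fun m _ => ⟨fun w => by beta_reduce; split_ifs <;> norm_num, by simp⟩ }

lemma detCode_isDeterministic {n : ℕ} {R : ℝ} (y : Fin (size n R) → Fin n → X)
    (f : (Fin n → X) → Fin (size n R)) : (detCode y f).IsDeterministic :=
  ⟨fun x _ => ⟨f x, by simp [detCode]⟩, fun m _ => ⟨y m, by simp [detCode]⟩⟩

lemma size_zero (n : ℕ) : size n 0 = 1 := by simp [size]

open Classical in
lemma detCode_law {n : ℕ} {R : ℝ} (y : Fin (size n R) → Fin n → X)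
    (f : (Fin n → X) → Fin (size n R)) (p : X → ℝ) (z : (Fin n → X) × (Fin n → X)) :
    (detCode y f).law p z = ∑ x, if (x, y (f x)) = z then iid p n x else 0 := by
  obtain ⟨x, w⟩ := z
  simp only [Code.law, detCode, Prod.mk.injEq]
  rw [Finset.sum_eq_single x (fun x' _ h => by simp [h]) (by simp)]
  simp only [size_zero, Nat.cast_one, div_one, mul_one, mul_ite, mul_zero, true_and]
  rw [Fintype.sum_eq_single ⟨0, by simp [size_zero]⟩ (fun j h => absurd (Fin.ext (by
    have := j.2
    simp only [size_zero] at this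
    simp; omega)) h)]
  rw [Fintype.sum_eq_single (f x) (fun m h => by simp [h.symm])]
  simp

lemma expScore_detCode {n : ℕ} {R : ℝ} (y : Fin (size n R) → Fin n → X)
    (f : (Fin n → X) → Fin (size n R)) (p : X → ℝ) (δ : List X → ℝ) (b : ℕ) :
    expScore p δ (detCode y f) b = prodExp (fun _ : Fin b => iid p n)
      (fun x => δ (List.ofFn fun k => List.ofFn (y (f (x k)))).flatten) := by
  classical
  have h := prodExp_comp (fun _ : Fin b => iid p n) (fun x => (x, y (f x)))
    (fun z => δ (batchWord z))
  change prodExp (fun _ : Fin b => (detCode y f).law p) (fun z => δ (batchWord z)) = _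
  have h2 : (fun _ : Fin b => (detCode y f).law p) = fun _ z =>
      ∑ x, if (x, y (f x)) = z then iid p n x else 0 := by
    funext _ z
    exact detCode_law y f p z
  rw [h2, ← h]
  rfl

lemma expDist_detCode {n : ℕ} {R : ℝ} (y : Fin (size n R) → Fin n → X)
    (f : (Fin n → X) → Fin (size n R)) {p : X → ℝ} (hp : ∑ x, p x = 1) (d : X → X → ℝ) {b : ℕ}
    (hb : 1 ≤ b) : expDist p d (detCode y f) b =
      ∑ x, iid p n x * (1 / (n : ℝ) * ∑ t, d (x t) (y (f x) t)) := by
  classical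
  rw [expDist_eq _ le_rfl hp d hb]
  simp only [detCode_law, Finset.sum_mul]
  rw [Finset.sum_comm]
  refine Finset.sum_congr rfl fun x _ => ?_
  rw [Finset.sum_eq_single (x, y (f x)) (fun z _ h => by simp [h.symm]) (by simp)]
  simp

/-- Batches of `b` words of length `n` are words of length `b * n`. -/
def batchEquiv (X : Type*) (b n : ℕ) : (Fin b → Fin n → X) ≃ (Fin (b * n) → X) :=
  (Equiv.curry (Fin b) (Fin n) X).symm.trans (finProdFinEquiv.arrowCongr (Equiv.refl X))

lemma ofFn_batchEquiv {X : Type*} {b n : ℕ} (y : Fin b → Fin n → X) :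
    List.ofFn (batchEquiv X b n y) = (List.ofFn fun k => List.ofFn (y k)).flatten := by
  rw [List.ofFn_mul]
  congr 2
  funext k
  congr 1
  funext t
  have h : (⟨(k : ℕ) * n + t, by
      calc (k : ℕ) * n + t < (k + 1) * n := by rw [add_mul, one_mul]; exact Nat.add_lt_add_left t.2 _
        _ ≤ b * n := Nat.mul_le_mul_right _ k.2⟩ : Fin (b * n)) = finProdFinEquiv (k, t) := by
    ext
    simp [mul_comm, add_comm]
  change y (finProdFinEquiv.symm _).1 (finProdFinEquiv.symm _).2 = y k t
  rw [h, Equiv.symm_apply_apply]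

lemma iid_batchEquiv {X : Type*} (p : X → ℝ) {b n : ℕ} (y : Fin b → Fin n → X) :
    iid p (b * n) (batchEquiv X b n y) = ∏ k, iid p n (y k) := by
  simp only [iid]
  rw [← finProdFinEquiv.prod_comp, Fintype.prod_prod_type]
  refine Finset.prod_congr rfl fun k _ => Finset.prod_congr rfl fun t _ => ?_
  congr 1
  change y (finProdFinEquiv.symm _).1 (finProdFinEquiv.symm _).2 = y k t
  rw [Equiv.symm_apply_apply]

lemma prodExp_flatten (p : X → ℝ) (b n : ℕ) (h : List X → ℝ) :
    prodExp (fun _ : Fin b => iid p n) (fun y => h (List.ofFn fun k => List.ofFn (y k)).flatten) =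
      ∑ x : Fin (b * n) → X, iid p (b * n) x * h (List.ofFn x) := by
  rw [← (batchEquiv X b n).sum_comp]
  simp only [ofFn_batchEquiv, iid_batchEquiv, prodExp]

end codes

/-! ### Countably many critics -/

/-- A partial recursive code determines the approximating sequence, which determines its limit, and
there are countably many codes. -/
lemma countable_setOf_lowerSemicomputable (α : Type*) [Primcodable α] :
    {f : α → ℝ | LowerSemicomputable f}.Countable := by
  have H : ∀ f : {f : α → ℝ // LowerSemicomputable f}, ∃ (c : Nat.Partrec.Code)
      (φ : α × ℕ → Bool × ℕ × ℕ),
      (∀ x, c.eval (Encodable.encode x) = Part.some (Encodable.encode (φ x))) ∧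
      ∀ x, Tendsto (fun k : ℕ => ((toRat (φ (x, k)) : ℚ) : ℝ)) atTop (𝓝 (f.1 x)) := by
    rintro ⟨f, φ, hφ, hlim, -⟩
    obtain ⟨c, hc⟩ := Nat.Partrec.Code.exists_code.1 hφ
    refine ⟨c, φ, fun x => ?_, hlim⟩
    rw [hc]
    simp
  choose c φ hc hφ using H
  refine Set.countable_coe_iff.1 (Function.Injective.countable (f := c) fun f g hfg => ?_)
  have h1 : φ f = φ g := by
    funext x
    have h2 := hc f x
    rw [hfg, hc g x] at h2
    exact (Encodable.encode_injective (Part.some_inj.1 h2)).symm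
  ext x
  have h2 := hφ f x
  rw [h1] at h2
  exact tendsto_nhds_unique h2 (hφ g x)

/-! ### Mixtures of finitely many critics -/

section mixture

variable {X : Type*} [Fintype X]

open Classical in
/-- The mixture of the critics among the first `n` terms of a sequence. -/
def mixture (p : X → ℝ) (δ : ℕ → List X → ℝ) (n : ℕ) (l : List X) : ℝ :=
  ∑ i ∈ Finset.range n, if IsCritic p (δ i) then (1 / 2 : ℝ) ^ (i + 1) * (2 : ℝ) ^ δ i l else 0

lemma mixture_nonneg (p : X → ℝ) (δ : ℕ → List X → ℝ) (n : ℕ) (l : List X) :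
    0 ≤ mixture p δ n l :=
  Finset.sum_nonneg fun i _ => by split_ifs <;> positivity

/-- The weights sum to at most `1 - 2^{-n}`, so the mixture inherits the critic inequality at every
length. -/
lemma sum_iid_mul_mixture_le (p : X → ℝ) (δ : ℕ → List X → ℝ) (n : ℕ) {N : ℕ} (hN : 1 ≤ N) :
    ∑ x : Fin N → X, iid p N x * mixture p δ n (List.ofFn x) ≤ 1 := by
  classical
  simp only [mixture, Finset.mul_sum]
  rw [Finset.sum_comm]
  calc _ ≤ ∑ i ∈ Finset.range n, (1 / 2 : ℝ) ^ (i + 1) := by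
        refine Finset.sum_le_sum fun i _ => ?_
        split_ifs with h
        · have h1 := mul_le_mul_of_nonneg_left (h N hN)
            (show (0 : ℝ) ≤ (1 / 2) ^ (i + 1) by positivity)
          rw [mul_one, Finset.mul_sum] at h1
          refine le_trans (le_of_eq ?_) h1
          exact Finset.sum_congr rfl fun x _ => by ring
        · simp
    _ = 1 - (1 / 2) ^ n := by
        induction n with
        | zero => simp
        | succ n ih => rw [Finset.sum_range_succ, ih]; ring
    _ ≤ 1 := by linarith [show (0 : ℝ) ≤ (1 / 2) ^ n by positivity]

/-- The score attached to a mixture of critics. -/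
def mixtureScore (p : X → ℝ) (δ : ℕ → List X → ℝ) (n : ℕ) (l : List X) : ℝ :=
  Real.logb 2 (1 + mixture p δ n l)

/-- The `1 +` inside the logarithm secures this sign, which the random coding bound requires. -/
lemma mixtureScore_nonneg (p : X → ℝ) (δ : ℕ → List X → ℝ) (n : ℕ) (l : List X) :
    0 ≤ mixtureScore p δ n l :=
  Real.logb_nonneg (by norm_num) (by linarith [mixture_nonneg p δ n l])

/-- This crude bound already gives mean score at most `2` under the source, uniformly in `n`. -/
lemma mixtureScore_le_two_mul (p : X → ℝ) (δ : ℕ → List X → ℝ) (n : ℕ) (l : List X) :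
    mixtureScore p δ n l ≤ 2 * mixture p δ n l := by
  have h0 := mixture_nonneg p δ n l
  have h1 := Real.log_le_sub_one_of_pos (show 0 < 1 + mixture p δ n l by linarith)
  have h2 := Real.log_two_gt_d9
  rw [mixtureScore, Real.logb, div_le_iff₀ (by linarith)]
  nlinarith

/-- The mixture dominates its `i`-th term, whose weight costs `i + 1` bits whatever `n` is. -/
lemma le_mixtureScore_add {p : X → ℝ} {δ : ℕ → List X → ℝ} {n i : ℕ} (hi : i < n)
    (hδ : IsCritic p (δ i)) (l : List X) : δ i l ≤ mixtureScore p δ n l + (i + 1) := by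
  classical
  have h1 : (1 / 2 : ℝ) ^ (i + 1) * (2 : ℝ) ^ δ i l ≤ mixture p δ n l := by
    have := Finset.single_le_sum (f := fun i => if IsCritic p (δ i) then
      (1 / 2 : ℝ) ^ (i + 1) * (2 : ℝ) ^ δ i l else 0)
      (fun i _ => by split_ifs <;> positivity) (Finset.mem_range.2 hi)
    simpa only [hδ, if_true, mixture] using this
  have h2 := Real.logb_le_logb_of_le (b := 2) (by norm_num)
    (show 0 < (1 / 2 : ℝ) ^ (i + 1) * (2 : ℝ) ^ δ i l by positivity)
    (h1.trans (show mixture p δ n l ≤ 1 + mixture p δ n l by linarith))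
  rw [Real.logb_mul (by positivity) (by positivity), Real.logb_rpow (by norm_num) (by norm_num),
    Real.logb_pow, one_div, Real.logb_inv, Real.logb_self_eq_one (by norm_num)] at h2
  push_cast at h2
  rw [mixtureScore]
  linarith

/-- The critic inequality bounds the mixture pointwise by the inverse probability of the word, which
is at most exponential in its length. Linear growth of the score lets exponentially small total
variation erase it. -/
lemma mixtureScore_ofFn_le {p : X → ℝ} (hpos : ∀ x, 0 < p x) (δ : ℕ → List X → ℝ) (n : ℕ)
    {N : ℕ} (hN : 1 ≤ N) (x : Fin N → X) :
    mixtureScore p δ n (List.ofFn x) ≤ 1 + N * ∑ a, |Real.logb 2 (p a)| := by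
  have hiid : ∀ x : Fin N → X, 0 < iid p N x := fun x => Finset.prod_pos fun t _ => hpos _
  have h0 := mixture_nonneg p δ n (List.ofFn x)
  have h1 : iid p N x * mixture p δ n (List.ofFn x) ≤ 1 :=
    (Finset.single_le_sum (f := fun x => iid p N x * mixture p δ n (List.ofFn x))
      (fun x _ => mul_nonneg (hiid x).le (mixture_nonneg p δ n _)) (Finset.mem_univ x)).trans
      (sum_iid_mul_mixture_le p δ n hN)
  have hle1 : -Real.logb 2 (iid p N x) ≤ N * ∑ a, |Real.logb 2 (p a)| := by
    rw [iid, Real.logb_prod _ _ (fun t _ => (hpos _).ne'), ← Finset.sum_neg_distrib]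
    refine (Finset.sum_le_sum fun t _ => (neg_le_abs _).trans
      (Finset.single_le_sum (f := fun a => |Real.logb 2 (p a)|) (fun a _ => abs_nonneg _)
        (Finset.mem_univ (x t)))).trans (le_of_eq ?_)
    simp
  set L := ∑ a, |Real.logb 2 (p a)|
  have hL : 0 ≤ L := Finset.sum_nonneg fun a _ => abs_nonneg _
  have h2 : mixture p δ n (List.ofFn x) ≤ (2 : ℝ) ^ ((N : ℝ) * L) := by
    have h3 : (iid p N x)⁻¹ ≤ (2 : ℝ) ^ ((N : ℝ) * L) := by
      rw [← Real.logb_le_iff_le_rpow (by norm_num) (inv_pos.2 (hiid x)), Real.logb_inv]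
      exact hle1
    refine le_trans ?_ h3
    rw [← one_div, le_div_iff₀ (hiid x)]
    linarith
  have h3 : (1 : ℝ) ≤ (2 : ℝ) ^ ((N : ℝ) * L) := Real.one_le_rpow (by norm_num) (by positivity)
  rw [mixtureScore, Real.logb_le_iff_le_rpow (by norm_num) (by linarith),
    Real.rpow_add (by norm_num), Real.rpow_one]
  linarith

end mixture

/-- Diagonal argument: the `n`-th code is built against the mixture of the critics among the first
`n` functions, so each fixed critic is under control from some `n` on. -/
theorem detAchievable_mutualInfo {X : Type*} [Fintype X] [Primcodable X] {p : X → ℝ}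
    (hp : p ∈ stdSimplex ℝ X) (hpos : ∀ x, 0 < p x) {d : X → X → ℝ} (hd : ∀ x y, 0 ≤ d x y)
    {B : ℕ → ℕ} (hB : ∀ n, 1 ≤ n → 1 ≤ B n)
    (hBlim : Tendsto (fun n : ℕ => Real.logb 2 (B n) / (n : ℝ)) atTop (𝓝 0))
    {Δ : ℝ} {W : X → X → ℝ} (hW : W ∈ feasible p d Δ) (hH : mutualInfo p W < entropy p) :
    DetAchievable p d B (mutualInfo p W) Δ := by
  classical
  intro ε hε
  obtain ⟨a₀⟩ : Nonempty X := by
    by_contra h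
    rw [not_nonempty_iff] at h
    simpa using hp.2
  -- The enumeration may list functions that are not critics; `mixture` discards them.
  obtain ⟨δ, hδ⟩ := Set.countable_iff_exists_subset_range.1
    (countable_setOf_lowerSemicomputable (List X))
  set L := ∑ a, |Real.logb 2 (p a)|
  have hL : 0 ≤ L := Finset.sum_nonneg fun a _ => abs_nonneg _
  obtain ⟨C, hC⟩ := eventually_exists_code hp hpos hd hB hBlim hW hH
    (g := fun n z => mixtureScore p δ n (List.ofFn fun k => List.ofFn (z k)).flatten)
    (fun n z => mixtureScore_nonneg p δ n _) (L := L) (E := 2) hL (by norm_num)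
    (fun n z => by
      rcases Nat.eq_zero_or_pos n with rfl | hn
      · simp [mixtureScore, mixture]
      · rw [← ofFn_batchEquiv, mul_comm n]
        exact mixtureScore_ofFn_le hpos δ n (Nat.mul_pos (hB n hn) hn) _)
    (fun n hn => by
      rw [prodExp_flatten p (B n) n (mixtureScore p δ n)]
      have h1 := sum_iid_mul_mixture_le p δ n (Nat.mul_pos (hB n hn) hn)
      calc _ ≤ ∑ x : Fin (B n * n) → X, 2 * (iid p (B n * n) x * mixture p δ n (List.ofFn x)) :=
            Finset.sum_le_sum fun x _ => by
              have := mul_le_mul_of_nonneg_left (mixtureScore_le_two_mul p δ n (List.ofFn x))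
                (iid_nonneg hp.1 _ x)
              linarith
        _ ≤ 2 := by rw [← Finset.mul_sum]; linarith) hε
  have hR : 0 ≤ mutualInfo p W + ε := add_nonneg (mutualInfo_nonneg hp hW.1) hε.le
  -- Good codes exist only for large `n`; a constant code fills the remaining lengths.
  have hex : ∀ n, ∃ (y : Fin (size n (mutualInfo p W + ε)) → Fin n → X)
      (f : (Fin n → X) → Fin (size n (mutualInfo p W + ε))),
      (∃ (y : Fin (size n (mutualInfo p W + ε)) → Fin n → X)
        (f : (Fin n → X) → Fin (size n (mutualInfo p W + ε))),
        ∑ x, iid p n x * (1 / (n : ℝ) * ∑ t, d (x t) (y (f x) t)) ≤ Δ + ε ∧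
        prodExp (fun _ : Fin (B n) => iid p n) (fun x => mixtureScore p δ n
          (List.ofFn fun k => List.ofFn (y (f (x k)))).flatten) ≤ C) →
      ∑ x, iid p n x * (1 / (n : ℝ) * ∑ t, d (x t) (y (f x) t)) ≤ Δ + ε ∧
      prodExp (fun _ : Fin (B n) => iid p n) (fun x => mixtureScore p δ n
        (List.ofFn fun k => List.ofFn (y (f (x k)))).flatten) ≤ C := by
    intro n
    by_cases h : ∃ (y : Fin (size n (mutualInfo p W + ε)) → Fin n → X)
        (f : (Fin n → X) → Fin (size n (mutualInfo p W + ε))),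
        ∑ x, iid p n x * (1 / (n : ℝ) * ∑ t, d (x t) (y (f x) t)) ≤ Δ + ε ∧
        prodExp (fun _ : Fin (B n) => iid p n) (fun x => mixtureScore p δ n
          (List.ofFn fun k => List.ofFn (y (f (x k)))).flatten) ≤ C
    · obtain ⟨y, f, hyf⟩ := h
      exact ⟨y, f, fun _ => hyf⟩
    · exact ⟨fun _ _ => a₀, fun _ => ⟨0, size_pos hR⟩, fun h' => absurd h' h⟩
  choose y f hyf using hex
  refine ⟨fun n => detCode (y n) (f n), fun n => detCode_isDeterministic _ _, ?_, ?_⟩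
  · refine limsup_le_of_le (h := ?_)
    filter_upwards [hC, eventually_ge_atTop 1] with n hn hn1
    rw [expDist_detCode _ _ hp.2 d (hB n hn1)]
    exact EReal.coe_le_coe_iff.2 (hyf n hn).1
  · intro δ' hcrit hlsc
    obtain ⟨i, rfl⟩ := hδ hlsc
    have hev : ∀ᶠ n in atTop, expScore p (δ i) (detCode (y n) (f n)) (B n) ≤ C + (i + 1) := by
      filter_upwards [hC, eventually_gt_atTop i] with n hn hni
      rw [expScore_detCode]
      have h1 := prodExp_mono (w := fun _ : Fin (B n) => iid p n) (fun _ => iid_nonneg hp.1 n)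
        (fun x => le_mixtureScore_add hni hcrit
          (List.ofFn fun k => List.ofFn (y n (f n (x k)))).flatten)
      rw [prodExp_add, prodExp_const fun _ => sum_iid hp.2 n] at h1
      exact h1.trans (by linarith [(hyf n hn).2])
    obtain ⟨N, hN⟩ := eventually_atTop.1 hev
    -- The supremum is over all `n`, so the finitely many early scores are added to the constant.
    refine ⟨|C + (i + 1)| + ∑ n ∈ Finset.range N, |expScore p (δ i) (detCode (y n) (f n)) (B n)|,
      fun n _ => ?_⟩
    have h0 := Finset.sum_nonneg fun n (_ : n ∈ Finset.range N) =>
      abs_nonneg (expScore p (δ i) (detCode (y n) (f n)) (B n))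
    rcases lt_or_ge n N with h | h
    · have h1 := Finset.single_le_sum (f := fun n =>
        |expScore p (δ i) (detCode (y n) (f n)) (B n)|) (fun n _ => abs_nonneg _)
        (Finset.mem_range.2 h)
      have h2 := le_abs_self (expScore p (δ i) (detCode (y n) (f n)) (B n))
      have h3 := abs_nonneg (C + ((i : ℝ) + 1))
      linarith
    · have h2 := le_abs_self (C + ((i : ℝ) + 1))
      linarith [hN n h]

/-! ### Converse -/

section converse

variable {X : Type*} [Fintype X]

open Classical in
/-- The law of source and reconstruction letters at a uniformly chosen time. -/
def Code.letterLaw {n : ℕ} {R Rc : ℝ} (c : Code X n R Rc) (p : X → ℝ) (x y : X) : ℝ :=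
  1 / (n : ℝ) * ∑ t : Fin n, ∑ z, if z.1 t = x ∧ z.2 t = y then c.law p z else 0

lemma Code.letterLaw_nonneg {n : ℕ} {R Rc : ℝ} (c : Code X n R Rc) {p : X → ℝ}
    (hp : ∀ x, 0 ≤ p x) (x y : X) : 0 ≤ c.letterLaw p x y :=
  mul_nonneg (by positivity) (Finset.sum_nonneg fun t _ => Finset.sum_nonneg fun z _ => by
    split_ifs
    exacts [c.law_nonneg hp z, le_rfl])

/-- Single-letterization: source marginal, distortion, information and additive scores of the letter
law are all computed through this identity. -/
lemma Code.sum_letterLaw_mul {n : ℕ} {R Rc : ℝ} (c : Code X n R Rc) (p : X → ℝ)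
    (h : X → X → ℝ) : ∑ x, ∑ y, c.letterLaw p x y * h x y =
      ∑ z, c.law p z * (1 / (n : ℝ) * ∑ t, h (z.1 t) (z.2 t)) := by
  classical
  have h1 : ∀ x y, c.letterLaw p x y * h x y = 1 / (n : ℝ) * ∑ t : Fin n, ∑ z,
      if z.1 t = x ∧ z.2 t = y then c.law p z * h x y else 0 := fun x y => by
    rw [Code.letterLaw, mul_assoc, Finset.sum_mul]
    simp only [Finset.sum_mul, ite_mul, zero_mul]
  have h2 : ∀ z, c.law p z * (1 / (n : ℝ) * ∑ t, h (z.1 t) (z.2 t)) =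
      1 / (n : ℝ) * ∑ t : Fin n, c.law p z * h (z.1 t) (z.2 t) := fun z => by
    rw [← Finset.mul_sum]; ring
  simp only [h1, h2, ← Finset.mul_sum]
  congr 1
  simp only [Finset.mul_sum]
  rw [← Fintype.sum_prod_type' (f := fun x y => ∑ t : Fin n, ∑ z,
      if z.1 t = x ∧ z.2 t = y then c.law p z * h x y else 0), Finset.sum_comm]
  rw [Finset.sum_comm (s := (Finset.univ : Finset ((Fin n → X) × (Fin n → X))))]
  refine Finset.sum_congr rfl fun t _ => ?_
  rw [Finset.sum_comm]
  refine Finset.sum_congr rfl fun z _ => ?_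
  rw [Finset.sum_eq_single (z.1 t, z.2 t)]
  · simp
  · rintro ⟨x, y⟩ _ hne
    rw [if_neg]
    rintro ⟨rfl, rfl⟩
    exact hne rfl
  · simp

lemma Code.sum_letterLaw_snd {n : ℕ} (hn : 1 ≤ n) {R Rc : ℝ} (c : Code X n R Rc) (hRc : 0 ≤ Rc)
    {p : X → ℝ} (hp : ∑ x, p x = 1) (x : X) : ∑ y, c.letterLaw p x y = p x := by
  classical
  have hn' : (0 : ℝ) < n := by exact_mod_cast hn
  have h := c.sum_letterLaw_mul p (fun x' _ => if x' = x then 1 else 0)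
  simp only [← Finset.sum_mul] at h
  rw [Finset.sum_eq_single x (fun x' _ hx' => by simp [hx']) (by simp)] at h
  rw [if_pos rfl, mul_one, Fintype.sum_prod_type] at h
  rw [h]
  have h2 : ∀ x', ∑ y, c.law p (x', y) * (1 / (n : ℝ) * ∑ t, if x' t = x then 1 else 0) =
      iid p n x' * (1 / (n : ℝ) * ∑ t, if x' t = x then 1 else 0) := fun x' => by
    rw [← Finset.sum_mul, c.sum_law_snd hRc]
  refine (Finset.sum_congr rfl fun x' _ => h2 x').trans ?_
  change prodExp (fun _ : Fin n => p) (fun z => 1 / (n : ℝ) * ∑ t, if z t = x then 1 else 0) = p x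
  rw [prodExp_const_mul, prodExp_sum]
  have h1 : ∀ t : Fin n, prodExp (fun _ : Fin n => p) (fun z => if z t = x then (1 : ℝ) else 0) =
      p x := fun t => by
    rw [prodExp_coord (fun _ => hp) t (fun a => if a = x then (1 : ℝ) else 0)]
    simp
  simp only [h1, Finset.sum_const, Finset.card_univ, Fintype.card_fin, nsmul_eq_mul]
  field_simp

/-- The conditional law of the reconstruction letter at a uniformly chosen time. -/
def Code.letterChannel {n : ℕ} {R Rc : ℝ} (c : Code X n R Rc) (p : X → ℝ) (x y : X) : ℝ :=
  c.letterLaw p x y / p x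

lemma Code.mul_letterChannel {n : ℕ} {R Rc : ℝ} (c : Code X n R Rc) {p : X → ℝ}
    (hpos : ∀ x, 0 < p x) (x y : X) : p x * c.letterChannel p x y = c.letterLaw p x y := by
  rw [Code.letterChannel, mul_div_cancel₀ _ (hpos x).ne']

lemma Code.letterChannel_mem {n : ℕ} (hn : 1 ≤ n) {R Rc : ℝ} (c : Code X n R Rc) (hRc : 0 ≤ Rc)
    {p : X → ℝ} (hp : p ∈ stdSimplex ℝ X) (hpos : ∀ x, 0 < p x) (x : X) :
    c.letterChannel p x ∈ stdSimplex ℝ X := by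
  refine ⟨fun y => div_nonneg (c.letterLaw_nonneg hp.1 x y) (hpos x).le, ?_⟩
  simp only [Code.letterChannel]
  rw [← Finset.sum_div, c.sum_letterLaw_snd hn hRc hp.2, div_self (hpos x).ne']

lemma Code.dist_letterChannel {n : ℕ} {R Rc : ℝ} (c : Code X n R Rc) (hRc : 0 ≤ Rc)
    {p : X → ℝ} (hp : p ∈ stdSimplex ℝ X) (hpos : ∀ x, 0 < p x) (d : X → X → ℝ) {b : ℕ}
    (hb : 1 ≤ b) : ∑ x, ∑ y, p x * c.letterChannel p x y * d x y = expDist p d c b := by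
  simp only [c.mul_letterChannel hpos]
  rw [c.sum_letterLaw_mul, expDist_eq c hRc hp.2 d hb]

/-- The rate of a code bounds the mutual information of its letter channel. -/
theorem Code.mutualInfo_letterChannel_le {n : ℕ} (hn : 1 ≤ n) {R Rc : ℝ} (c : Code X n R Rc)
    (hR : 0 ≤ R) (hRc : 0 ≤ Rc) {p : X → ℝ} (hp : p ∈ stdSimplex ℝ X) (hpos : ∀ x, 0 < p x) :
    mutualInfo p (c.letterChannel p) ≤ R := by
  have hn' : (0 : ℝ) < n := by exact_mod_cast hn
  have hs : (0 : ℝ) < size n R := by exact_mod_cast size_pos hR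
  have hsc : (0 : ℝ) < size n Rc := by exact_mod_cast size_pos hRc
  set J := c.letterLaw p with hJ
  have hJ0 : ∀ x y, 0 ≤ J x y := c.letterLaw_nonneg hp.1
  set q : X → ℝ := fun y => ∑ x, J x y with hq
  have hq0 : ∀ y, 0 ≤ q y := fun y => Finset.sum_nonneg fun x _ => hJ0 x y
  have hJq : ∀ x y, 0 < J x y → 0 < q y := fun x y h => lt_of_lt_of_le h
    (Finset.single_le_sum (f := fun x => J x y) (fun x _ => hJ0 x y) (Finset.mem_univ x))
  -- The output law when message and common randomness are both uniform. Bounding `enc` by one gives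
  -- `law ≤ iid * size * Q`, which is where the rate enters.
  set Q : (Fin n → X) → ℝ := fun y =>
    ∑ j, ∑ m, 1 / (size n Rc : ℝ) * (1 / (size n R : ℝ)) * c.dec m j y with hQ
  have hQ0 : ∀ y, 0 ≤ Q y := fun y => Finset.sum_nonneg fun j _ => Finset.sum_nonneg fun m _ =>
    mul_nonneg (by positivity) ((c.dec_mem m j).1 y)
  have hQ1 : ∑ y, Q y = 1 := by
    simp only [hQ]
    rw [Finset.sum_comm]
    have h1 : ∀ j, ∑ y, ∑ m, 1 / (size n Rc : ℝ) * (1 / (size n R : ℝ)) * c.dec m j y =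
        1 / (size n Rc : ℝ) := fun j => by
      rw [Finset.sum_comm]
      simp only [← Finset.mul_sum, (c.dec_mem _ _).2, mul_one, Finset.sum_const, Finset.card_univ,
        Fintype.card_fin, nsmul_eq_mul]
      field_simp
    simp only [h1, Finset.sum_const, Finset.card_univ, Fintype.card_fin, nsmul_eq_mul]
    field_simp
  have hlawQ : ∀ z, c.law p z ≤ iid p n z.1 * size n R * Q z.2 := by
    intro z
    have h1 : iid p n z.1 * size n R * Q z.2 =
        ∑ j, ∑ m, iid p n z.1 * (1 / (size n Rc : ℝ)) * 1 * c.dec m j z.2 := by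
      simp only [hQ, Finset.mul_sum]
      refine Finset.sum_congr rfl fun j _ => Finset.sum_congr rfl fun m _ => ?_
      field_simp
    rw [h1, Code.law]
    refine Finset.sum_le_sum fun j _ => Finset.sum_le_sum fun m _ => ?_
    have h2 : c.enc z.1 j m ≤ 1 := by
      rw [← (c.enc_mem z.1 j).2]
      exact Finset.single_le_sum (fun m _ => (c.enc_mem z.1 j).1 m) (Finset.mem_univ m)
    have h3 := (c.dec_mem m j).1 z.2
    have h4 := iid_nonneg hp.1 n z.1
    gcongr
  have hlaw0 := c.law_nonneg (p := p) hp.1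
  have hlawJ : ∀ z, 0 < c.law p z → ∀ t, 0 < J (z.1 t) (z.2 t) := by
    classical
    intro z hz t
    rw [hJ, Code.letterLaw]
    refine mul_pos (by positivity) (lt_of_lt_of_le hz ?_)
    have h0 : ∀ s : Fin n, ∀ z', 0 ≤ if z'.1 s = z.1 t ∧ z'.2 s = z.2 t then c.law p z' else 0 :=
      fun s z' => by
        split_ifs
        exacts [hlaw0 _, le_rfl]
    refine le_trans ?_ (Finset.single_le_sum (fun s _ => Finset.sum_nonneg fun z' _ => h0 s z')
      (Finset.mem_univ t))
    refine le_trans ?_ (Finset.single_le_sum (fun z' _ => h0 t z') (Finset.mem_univ z))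
    simp
  -- Output drawn from `Q`, then source letters independently from the reverse letter channel: a
  -- subprobability. Gibbs' inequality for the code law against `T` yields the single-letter bound
  -- directly.
  set T : (Fin n → X) × (Fin n → X) → ℝ := fun z => Q z.2 * ∏ t, J (z.1 t) (z.2 t) / q (z.2 t)
    with hT
  have hT0 : ∀ z, 0 ≤ T z := fun z =>
    mul_nonneg (hQ0 _) (Finset.prod_nonneg fun t _ => div_nonneg (hJ0 _ _) (hq0 _))
  have hQpos : ∀ z, 0 < c.law p z → 0 < Q z.2 := fun z hz => by
    refine (hQ0 _).lt_of_ne fun h => ?_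
    have := hlawQ z
    rw [← h, mul_zero] at this
    linarith
  have hTpos : ∀ z, 0 < c.law p z → 0 < T z := fun z hz =>
    mul_pos (hQpos z hz) (Finset.prod_pos fun t _ =>
      div_pos (hlawJ z hz t) (hJq _ _ (hlawJ z hz t)))
  have hTsum : ∑ z, T z ≤ ∑ z, c.law p z := by
    classical
    rw [c.sum_law hRc hp.2, Fintype.sum_prod_type_right, ← hQ1]
    refine Finset.sum_le_sum fun y _ => ?_
    simp only [hT, ← Finset.mul_sum]
    refine mul_le_of_le_one_right (hQ0 y) ?_
    have h1 : ∑ x : Fin n → X, ∏ t, J (x t) (y t) / q (y t) = ∏ t, ∑ x, J x (y t) / q (y t) := by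
      rw [Finset.prod_univ_sum, Fintype.piFinset_univ]
    rw [h1]
    refine Finset.prod_le_one (fun t _ => Finset.sum_nonneg fun x _ =>
      div_nonneg (hJ0 _ _) (hq0 _)) fun t _ => ?_
    rw [← Finset.sum_div]
    exact div_self_le_one _
  have hG := sum_mul_logb_div_nonneg hlaw0 hT0 hTpos hTsum
  have hbound : ∀ z, c.law p z * Real.logb 2 (c.law p z / T z) ≤ c.law p z * (n * R) -
      c.law p z * ∑ t, Real.logb 2 (J (z.1 t) (z.2 t) / (p (z.1 t) * q (z.2 t))) := by
    intro z
    rcases (hlaw0 z).eq_or_lt with h | h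
    · rw [← h]; simp
    · rw [← mul_sub]
      refine mul_le_mul_of_nonneg_left ?_ h.le
      have hJz := hlawJ z h
      have hqz := fun t => hJq _ _ (hJz t)
      have hprod : 0 < ∏ t, J (z.1 t) (z.2 t) / (p (z.1 t) * q (z.2 t)) :=
        Finset.prod_pos fun t _ => div_pos (hJz t) (mul_pos (hpos _) (hqz t))
      have hpp : 0 < iid p n z.1 := Finset.prod_pos fun t _ => hpos _
      have hTe : T z = Q z.2 * (iid p n z.1 *
          ∏ t, J (z.1 t) (z.2 t) / (p (z.1 t) * q (z.2 t))) := by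
        simp only [hT, iid]
        rw [← Finset.prod_mul_distrib]
        congr 1
        refine Finset.prod_congr rfl fun t _ => ?_
        have := (hpos (z.1 t)).ne'
        have := (hqz t).ne'
        field_simp
      have h1 : c.law p z / T z ≤ (2 : ℝ) ^ ((n : ℝ) * R) /
          ∏ t, J (z.1 t) (z.2 t) / (p (z.1 t) * q (z.2 t)) := by
        rw [div_le_div_iff₀ (hTpos z h) hprod, hTe]
        have h2 := mul_le_mul_of_nonneg_right (hlawQ z) hprod.le
        have h3 := mul_le_mul_of_nonneg_right (size_le n R)
          (show 0 ≤ Q z.2 * (iid p n z.1 * ∏ t, J (z.1 t) (z.2 t) / (p (z.1 t) * q (z.2 t))) from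
            mul_nonneg (hQ0 _) (mul_nonneg hpp.le hprod.le))
        linarith
      have h2 := Real.logb_le_logb_of_le (b := 2) (by norm_num) (div_pos h (hTpos z h)) h1
      rw [Real.logb_div (by positivity) hprod.ne', Real.logb_rpow (by norm_num) (by norm_num),
        Real.logb_prod _ _ (fun t _ => (div_pos (hJz t) (mul_pos (hpos _) (hqz t))).ne')] at h2
      exact h2
  have hsum := hG.trans (Finset.sum_le_sum fun z _ => hbound z)
  rw [Finset.sum_sub_distrib, ← Finset.sum_mul, c.sum_law hRc hp.2, one_mul] at hsum
  have hI : mutualInfo p (c.letterChannel p) = ∑ z, c.law p z * (1 / (n : ℝ) *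
      ∑ t, Real.logb 2 (J (z.1 t) (z.2 t) / (p (z.1 t) * q (z.2 t)))) := by
    rw [← c.sum_letterLaw_mul p (fun x y => Real.logb 2 (J x y / (p x * q y))), mutualInfo]
    simp only [c.mul_letterChannel hpos, hq, hJ]
  have hI2 : (n : ℝ) * mutualInfo p (c.letterChannel p) = ∑ z, c.law p z *
      ∑ t, Real.logb 2 (J (z.1 t) (z.2 t) / (p (z.1 t) * q (z.2 t))) := by
    rw [hI, Finset.mul_sum]
    refine Finset.sum_congr rfl fun z _ => ?_
    field_simp
  rw [← hI2] at hsum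
  have h3 : (n : ℝ) * mutualInfo p (c.letterChannel p) ≤ n * R := by linarith
  rw [mul_le_mul_iff_right₀ hn'] at h3
  exact h3

/-! ### Additive critics -/

/-- By linearity an additive score sees only the output letter law, and any positive drift is
amplified by the number of letters. -/
lemma expScore_additive {n : ℕ} (hn : 1 ≤ n) {R Rc : ℝ} (c : Code X n R Rc) (hRc : 0 ≤ Rc)
    {p : X → ℝ} (hp : p ∈ stdSimplex ℝ X) (hpos : ∀ x, 0 < p x) (s : X → ℝ) (b : ℕ) :
    expScore p (fun l => (l.map s).sum) c b =
      (b * n : ℝ) * ∑ y, (∑ x, p x * c.letterChannel p x y) * s y := by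
  have hn' : (0 : ℝ) < n := by exact_mod_cast hn
  simp only [c.mul_letterChannel hpos, Finset.sum_mul]
  rw [Finset.sum_comm, c.sum_letterLaw_mul p (fun _ y => s y)]
  have h1 : ∀ z : Fin b → (Fin n → X) × (Fin n → X), ((batchWord z).map s).sum =
      ∑ k, ∑ t, s ((z k).2 t) := fun z => by
    simp [batchWord, List.map_flatten, List.sum_flatten, List.map_ofFn, List.sum_ofFn,
      Function.comp_def]
  change prodExp (fun _ : Fin b => c.law p) (fun z => ((batchWord z).map s).sum) = _
  simp only [h1]
  rw [prodExp_sum]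
  have h2 := fun k : Fin b => prodExp_coord (w := fun _ : Fin b => c.law p)
    (fun _ => c.sum_law hRc hp.2) k (fun z => ∑ t, s (z.2 t))
  simp only [h2, Finset.sum_const, Finset.card_univ, Fintype.card_fin, nsmul_eq_mul]
  rw [mul_assoc]
  congr 1
  rw [Finset.mul_sum]
  refine Finset.sum_congr rfl fun z _ => ?_
  field_simp

lemma isCritic_additive {p : X → ℝ} (hp : ∀ x, 0 ≤ p x) {s : X → ℝ}
    (hs : ∑ x, p x * (2 : ℝ) ^ s x ≤ 1) : IsCritic p fun l => (l.map s).sum := by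
  intro n _
  have h := prodExp_prod (fun _ : Fin n => p) (fun _ x => (2 : ℝ) ^ s x)
  simp only [Finset.prod_const, Finset.card_univ, Fintype.card_fin] at h
  have h2 : ∑ x : Fin n → X, iid p n x * (2 : ℝ) ^ ((List.ofFn x).map s).sum =
      prodExp (fun _ : Fin n => p) (fun x => ∏ t, (2 : ℝ) ^ s (x t)) := by
    refine Finset.sum_congr rfl fun x _ => ?_
    rw [List.map_ofFn, List.sum_ofFn, Real.rpow_sum_of_pos (by norm_num)]
    rfl
  rw [h2, h]
  exact pow_le_one₀ (Finset.sum_nonneg fun x _ => mul_nonneg (hp x) (by positivity)) hs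

/-- With a common denominator the sum is an exactly computable rational, so a constant approximating
sequence works. -/
lemma lowerSemicomputable_additive [Primcodable X] (α β : X → ℕ) (D : ℕ) :
    LowerSemicomputable fun l : List X =>
      (l.map fun x => ((α x : ℝ) - β x) / ((D : ℝ) + 1)).sum := by
  have hfold : ∀ α : X → ℕ, Primrec fun l : List X × ℕ => l.1.foldr (fun x s => α x + s) 0 :=
    fun α => Primrec.list_foldr (h := fun _ bs => α bs.1 + bs.2) Primrec.fst (Primrec.const 0)
      (Primrec.nat_add.comp
        ((Primrec.dom_finite α).comp (Primrec.fst.comp Primrec.snd))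
        (Primrec.snd.comp Primrec.snd))
  set A : (X → ℕ) → List X → ℕ := fun α l => l.foldr (fun x s => α x + s) 0 with hA
  have hsum : ∀ l : List X, (l.map fun x => ((α x : ℝ) - β x) / ((D : ℝ) + 1)).sum =
      ((A α l : ℝ) - A β l) / ((D : ℝ) + 1) := by
    intro l
    induction l with
    | nil => simp [hA]
    | cons x l ih =>
      simp only [List.map_cons, List.sum_cons, ih, hA, List.foldr_cons]
      push_cast
      ring
  -- One of the two truncated differences is zero, so their sum is the absolute value. `toRat`
  -- stores the denominator minus one, hence `D`.
  refine ⟨fun l => (decide (A β l.1 ≤ A α l.1),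
    (A α l.1 - A β l.1) + (A β l.1 - A α l.1), D), ?_, ?_, ?_⟩
  · refine Primrec.to_comp (Primrec.pair ?_ (Primrec.pair ?_ (Primrec.const D)))
    · exact (Primrec.nat_le.comp (hfold β) (hfold α)).decide
    · exact Primrec.nat_add.comp (Primrec.nat_sub.comp (hfold α) (hfold β))
        (Primrec.nat_sub.comp (hfold β) (hfold α))
  · intro l
    refine tendsto_const_nhds.congr fun k => ?_
    beta_reduce
    rw [hsum, toRat]
    rcases le_total (A β l) (A α l) with h | h
    · have h' : A β l - A α l = 0 := Nat.sub_eq_zero_of_le h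
      simp [h, h', Nat.cast_sub h]
    · rcases h.eq_or_lt with h2 | h2
      · simp [h2]
      · have h' : A α l - A β l = 0 := Nat.sub_eq_zero_of_le h
        simp [not_le.2 h2, h', Nat.cast_sub h]
  · intro l k
    exact le_rfl

/-- A computable additive critic that detects an excess of the letter `a`. -/
lemma exists_critic_letter [Primcodable X] {p : X → ℝ} (hp : p ∈ stdSimplex ℝ X) (a : X) {τ : ℝ}
    (hτ : 0 < τ) : ∃ (s : X → ℝ) (κ : ℝ), 0 < κ ∧ IsCritic p (fun l => (l.map s).sum) ∧
      LowerSemicomputable (fun l : List X => (l.map s).sum) ∧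
      ∀ q : X → ℝ, ∑ y, q y = 1 → p a + τ ≤ q a → κ ≤ ∑ y, q y * s y := by
  classical
  have hpa : p a ≤ 1 := by
    rw [← hp.2]; exact Finset.single_le_sum (fun x _ => hp.1 x) (Finset.mem_univ a)
  have hl2 : Real.log 2 < 1 := by linarith [Real.log_two_lt_d9]
  have hl0 : 0 < Real.log 2 := Real.log_pos (by norm_num)
  obtain ⟨m, hm⟩ := exists_nat_one_div_lt (show 0 < min τ 1 by positivity)
  set e : ℝ := 1 / ((m : ℝ) + 1) with he
  have he0 : 0 < e := by positivity
  have heτ : e < τ := hm.trans_le (min_le_left _ _)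
  have he1 : e < 1 := hm.trans_le (min_le_right _ _)
  -- `Z` is the mean of `2^{e·1_a}` under `p`. To first order `log₂ Z` is `p a * e`, and `e < τ`
  -- makes the second-order error smaller than the room `τ * e`.
  set Z : ℝ := 1 + p a * ((2 : ℝ) ^ e - 1) with hZ
  have hpow : (2 : ℝ) ^ e = Real.exp (Real.log 2 * e) := by
    rw [Real.rpow_def_of_pos (by norm_num)]
  have hZ1 : 1 ≤ Z := by
    have := Real.one_le_rpow (show (1 : ℝ) ≤ 2 by norm_num) he0.le
    have := mul_nonneg (hp.1 a) (sub_nonneg.2 this)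
    linarith
  have hZlt : Z < (2 : ℝ) ^ ((p a + τ) * e) := by
    set u := Real.log 2 * e with hu
    have hu0 : 0 < u := by positivity
    have hue : u < e := by nlinarith
    have h1 := (abs_le.1 (Real.abs_exp_sub_one_sub_id_le (x := u)
      (by rw [abs_of_pos hu0]; linarith))).2
    have h2 := Real.add_one_le_exp ((p a + τ) * u)
    have h3 : (2 : ℝ) ^ ((p a + τ) * e) = Real.exp ((p a + τ) * u) := by
      rw [Real.rpow_def_of_pos (by norm_num)]; congr 1; rw [hu]; ring
    rw [h3, hZ, hpow]
    have h4 : p a * (Real.exp u - 1) ≤ p a * (u + u ^ 2) :=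
      mul_le_mul_of_nonneg_left (by linarith) (hp.1 a)
    have h5 : p a * u ^ 2 ≤ u ^ 2 := mul_le_of_le_one_left (by positivity) hpa
    have h6 : u ^ 2 < τ * u := by nlinarith
    nlinarith
  -- The lower bound on `r` makes `e·1_a - r` a critic, the upper bound gives it drift `κ > 0` under
  -- excess of `a`, and rationality makes it computable.
  obtain ⟨r, hr1, hr2⟩ := exists_rat_btwn
    ((Real.logb_lt_iff_lt_rpow (by norm_num) (by linarith)).2 hZlt)
  have hr0 : (0 : ℝ) ≤ r := (Real.logb_nonneg (by norm_num) hZ1).trans hr1.le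
  have hr0' : 0 ≤ r := by exact_mod_cast hr0
  have hrd : (0 : ℝ) < r.den := by exact_mod_cast r.den_pos
  have hrn : (r : ℝ) = (r.num.toNat : ℝ) / r.den := by
    have h1 : (r.num.toNat : ℤ) = r.num := Int.toNat_of_nonneg (Rat.num_nonneg.2 hr0')
    have h2 : (r.num.toNat : ℝ) = (r.num : ℝ) := by exact_mod_cast congrArg (Int.cast (R := ℝ)) h1
    rw [h2]
    exact Rat.cast_def r
  set s : X → ℝ := fun y => (if y = a then e else 0) - r with hs
  have hse : s = fun y => ((((if y = a then r.den else 0 : ℕ)) : ℝ) - (r.num.toNat * (m + 1) : ℕ)) /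
      ((((m + 1) * r.den - 1 : ℕ) : ℝ) + 1) := by
    funext y
    have h1 : 1 ≤ (m + 1) * r.den := Nat.mul_pos (Nat.succ_pos m) r.den_pos
    rw [Nat.cast_sub h1, hs]
    simp only [hrn, he]
    push_cast
    split_ifs <;> field_simp <;> ring
  refine ⟨s, e * (p a + τ) - r, by linarith, isCritic_additive hp.1 ?_, ?_, ?_⟩
  · have h1 : ∀ y, p y * (2 : ℝ) ^ s y =
        (p y + if y = a then p a * ((2 : ℝ) ^ e - 1) else 0) * (2 : ℝ) ^ (-(r : ℝ)) := fun y => by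
      simp only [hs]
      rw [sub_eq_add_neg, Real.rpow_add (by norm_num)]
      split_ifs with h
      · rw [h]; ring
      · simp
    simp only [h1, ← Finset.sum_mul, Finset.sum_add_distrib, hp.2, Finset.sum_ite_eq',
      Finset.mem_univ, if_true]
    rw [Real.rpow_neg (by norm_num), ← div_eq_mul_inv, div_le_one (by positivity)]
    exact ((Real.logb_lt_iff_lt_rpow (by norm_num) (by linarith)).1 hr1).le
  · rw [hse]
    exact lowerSemicomputable_additive (fun y => if y = a then r.den else 0)
      (fun _ => r.num.toNat * (m + 1)) ((m + 1) * r.den - 1)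
  · intro q hq hqa
    have h1 : ∑ y, q y * s y = e * q a - r := by
      simp only [hs, mul_sub, Finset.sum_sub_distrib, ← Finset.sum_mul, hq, one_mul, mul_ite,
        mul_zero, Finset.sum_ite_eq', Finset.mem_univ, if_true]
      ring
    rw [h1]
    have := mul_le_mul_of_nonneg_left hqa he0.le
    linarith

/-- Algorithmic realism forces the letters of the reconstruction to follow the source law. -/
lemma eventually_letterChannel_lt [Primcodable X] {p : X → ℝ} (hp : p ∈ stdSimplex ℝ X)
    (hpos : ∀ x, 0 < p x) {d : X → X → ℝ} {B : ℕ → ℕ} (hB : ∀ n, 1 ≤ n → 1 ≤ B n) {D R Rc : ℝ}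
    (hRc : 0 ≤ Rc) {c : ∀ n, Code X n R Rc} (hc : MeetsConstraints p d B D c) (a : X) {τ : ℝ}
    (hτ : 0 < τ) : ∀ᶠ n in atTop, ∑ x, p x * (c n).letterChannel p x a < p a + τ := by
  obtain ⟨s, κ, hκ, hcrit, hlsc, hs⟩ := exists_critic_letter hp a hτ
  obtain ⟨C, hC⟩ := hc.2 _ hcrit hlsc
  filter_upwards [eventually_ge_atTop 1, eventually_gt_atTop ⌈C / κ⌉₊] with n hn hnC
  by_contra! h
  have h1 := hC n hn
  rw [expScore_additive hn (c n) hRc hp hpos] at h1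
  have hsum : ∑ y, ∑ x, p x * (c n).letterChannel p x y = 1 := by
    rw [Finset.sum_comm]
    simp only [← Finset.mul_sum, ((c n).letterChannel_mem hn hRc hp hpos _).2, mul_one, hp.2]
  have h2 := hs _ hsum h
  have hb : (1 : ℝ) ≤ B n := by exact_mod_cast hB n hn
  have hn0 : (0 : ℝ) < n := by exact_mod_cast hn
  have h3 : C < n * κ := by
    rw [← div_lt_iff₀ hκ]
    exact lt_of_le_of_lt (Nat.le_ceil _) (by exact_mod_cast hnC)
  have h4 : (n : ℝ) * κ ≤ B n * n * κ := by
    have : 0 < (n : ℝ) * κ := by positivity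
    nlinarith
  have h5 := mul_le_mul_of_nonneg_left h2 (show (0 : ℝ) ≤ B n * n by positivity)
  linarith

/-! ### Compactness -/

/-- On channels, mutual information is `H(Y) - H(Y|X)`, a combination of `Real.negMulLog`, which is
continuous also at zero. -/
lemma continuousOn_mutualInfo {p : X → ℝ} (hpos : ∀ x, 0 < p x) :
    ContinuousOn (mutualInfo p) {W | ∀ x, W x ∈ stdSimplex ℝ X} := by
  have h : ∀ W ∈ {W : X → X → ℝ | ∀ x, W x ∈ stdSimplex ℝ X}, mutualInfo p W =
      (∑ y, Real.negMulLog (∑ x, p x * W x y) - ∑ x, ∑ y, p x * Real.negMulLog (W x y)) /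
        Real.log 2 := by
    intro W hW
    have h1 : ∀ x y, p x * W x y * Real.logb 2 (p x * W x y / (p x * ∑ x', p x' * W x' y)) =
        (-(p x * Real.negMulLog (W x y)) - p x * W x y * Real.log (∑ x', p x' * W x' y)) /
          Real.log 2 := by
      intro x y
      rcases ((hW x).1 y).eq_or_lt with h0 | h0
      · simp [← h0]
      · have hq : 0 < ∑ x', p x' * W x' y := lt_of_lt_of_le (mul_pos (hpos x) h0)
          (Finset.single_le_sum (f := fun x => p x * W x y)
            (fun x _ => mul_nonneg (hpos x).le ((hW x).1 y)) (Finset.mem_univ x))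
        rw [mul_div_mul_left _ _ (hpos x).ne', Real.logb, Real.log_div h0.ne' hq.ne',
          Real.negMulLog]
        ring
    simp only [mutualInfo, h1, ← Finset.sum_div]
    congr 1
    simp only [Finset.sum_sub_distrib, Finset.sum_neg_distrib]
    rw [Finset.sum_comm (f := fun x y => p x * W x y * Real.log (∑ x', p x' * W x' y))]
    simp only [← Finset.sum_mul, Real.negMulLog, neg_mul, Finset.sum_neg_distrib]
    ring
  refine ContinuousOn.congr (Continuous.continuousOn ?_) h
  have := Real.continuous_negMulLog
  fun_prop

lemma isCompact_channels : IsCompact {W : X → X → ℝ | ∀ x, W x ∈ stdSimplex ℝ X} := by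
  have := isCompact_univ_pi (fun _ : X => isCompact_stdSimplex ℝ X)
  simpa [Set.pi] using this

/-- A limiting letter channel of a sequence of codes that meets the constraints. -/
lemma exists_feasible_of_meetsConstraints [Primcodable X] {p : X → ℝ} (hp : p ∈ stdSimplex ℝ X)
    (hpos : ∀ x, 0 < p x) {d : X → X → ℝ} {B : ℕ → ℕ} (hB : ∀ n, 1 ≤ n → 1 ≤ B n) {D R Rc : ℝ}
    (hR : 0 ≤ R) (hRc : 0 ≤ Rc) {c : ∀ n, Code X n R Rc} (hc : MeetsConstraints p d B D c) :
    ∃ W ∈ feasible p d D, mutualInfo p W ≤ R := by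
  obtain ⟨W, hW, φ, hφ, hlim⟩ := isCompact_channels.tendsto_subseq
    (x := fun n => (c (n + 1)).letterChannel p)
    (fun n => (c (n + 1)).letterChannel_mem (Nat.le_add_left 1 n) hRc hp hpos)
  have hφ1 : Tendsto (fun k => φ k + 1) atTop atTop :=
    (tendsto_add_atTop_nat 1).comp hφ.tendsto_atTop
  have hmem : ∀ k, (c (φ k + 1)).letterChannel p ∈ {W : X → X → ℝ | ∀ x, W x ∈ stdSimplex ℝ X} :=
    fun k => (c (φ k + 1)).letterChannel_mem (Nat.le_add_left 1 _) hRc hp hpos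
  have hq : ∀ a, ∑ x, p x * W x a ≤ p a := by
    intro a
    refine le_of_forall_pos_le_add fun τ hτ => ?_
    have hcont : Continuous fun W : X → X → ℝ => ∑ x, p x * W x a := by fun_prop
    refine le_of_tendsto ((hcont.tendsto W).comp hlim) ?_
    filter_upwards [hφ1.eventually (eventually_letterChannel_lt hp hpos hB hRc hc a hτ)] with k hk
    exact hk.le
  -- Critics bound each output letter only from above; equal total mass turns the inequalities into
  -- equalities.
  have hsum : ∑ a, ∑ x, p x * W x a = ∑ a, p a := by
    rw [Finset.sum_comm]
    simp only [← Finset.mul_sum, (hW _).2, mul_one]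
  refine ⟨W, ⟨hW, fun a => (Finset.sum_eq_sum_iff_of_le fun a _ => hq a).1 hsum a
    (Finset.mem_univ a), ?_⟩, ?_⟩
  · refine le_of_forall_pos_le_add fun τ hτ => ?_
    have hcont : Continuous fun W : X → X → ℝ => ∑ x, ∑ y, p x * W x y * d x y := by fun_prop
    refine le_of_tendsto ((hcont.tendsto W).comp hlim) ?_
    have hlt : (D : EReal) < ((D + τ : ℝ) : EReal) := EReal.coe_lt_coe_iff.2 (by linarith)
    filter_upwards [hφ1.eventually (eventually_lt_of_limsup_lt (hc.1.trans_lt hlt))] with k hk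
    simp only [Function.comp_apply]
    rw [(c (φ k + 1)).dist_letterChannel hRc hp hpos d (hB _ (Nat.le_add_left 1 _))]
    exact (EReal.coe_lt_coe_iff.1 hk).le
  · have h1 : Tendsto (fun k => mutualInfo p ((c (φ k + 1)).letterChannel p)) atTop
        (𝓝 (mutualInfo p W)) :=
      ((continuousOn_mutualInfo hpos) W hW).tendsto.comp
        (tendsto_nhdsWithin_iff.2 ⟨hlim, Eventually.of_forall hmem⟩)
    exact le_of_tendsto' h1 fun k =>
      (c (φ k + 1)).mutualInfo_letterChannel_le (Nat.le_add_left 1 _) hR hRc hp hpos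

/-- A second compactness pass: the slack in rate and distortion tends to zero along a subsequence of
limiting channels. -/
theorem rdp_le_of_achievable [Primcodable X] {p : X → ℝ} (hp : p ∈ stdSimplex ℝ X)
    (hpos : ∀ x, 0 < p x) {d : X → X → ℝ} {B : ℕ → ℕ} (hB : ∀ n, 1 ≤ n → 1 ≤ B n) {Δ R Rc : ℝ}
    (hR : 0 ≤ R) (hRc : 0 ≤ Rc) (h : Achievable p d B R Rc Δ) : rdp p d Δ ≤ (R : EReal) := by
  have hε : ∀ k : ℕ, (0 : ℝ) < 1 / ((k : ℝ) + 1) := fun k => by positivity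
  have H : ∀ k : ℕ, ∃ W ∈ feasible p d (Δ + 1 / ((k : ℝ) + 1)),
      mutualInfo p W ≤ R + 1 / ((k : ℝ) + 1) := fun k => by
    obtain ⟨c, hc⟩ := h _ (hε k)
    exact exists_feasible_of_meetsConstraints hp hpos hB (by linarith [hε k]) hRc hc
  choose V hV hVR using H
  obtain ⟨W, hW, φ, hφ, hlim⟩ := isCompact_channels.tendsto_subseq (x := V) fun k => (hV k).1
  have hε0 : Tendsto (fun k => 1 / ((φ k : ℝ) + 1)) atTop (𝓝 0) :=
    tendsto_one_div_add_atTop_nhds_zero_nat.comp hφ.tendsto_atTop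
  have hfeas : W ∈ feasible p d Δ := by
    refine ⟨hW, fun y => ?_, ?_⟩
    · have hcont : Continuous fun W : X → X → ℝ => ∑ x, p x * W x y := by fun_prop
      refine tendsto_nhds_unique ((hcont.tendsto W).comp hlim) ?_
      exact tendsto_const_nhds.congr fun k => ((hV (φ k)).2.1 y).symm
    · have hcont : Continuous fun W : X → X → ℝ => ∑ x, ∑ y, p x * W x y * d x y := by fun_prop
      have h1 := hε0.const_add Δ
      rw [add_zero] at h1
      exact le_of_tendsto_of_tendsto' ((hcont.tendsto W).comp hlim) h1 fun k => (hV (φ k)).2.2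
  have hI : mutualInfo p W ≤ R := by
    have h1 := hε0.const_add R
    rw [add_zero] at h1
    exact le_of_tendsto_of_tendsto' (((continuousOn_mutualInfo hpos) W hW).tendsto.comp
      (tendsto_nhdsWithin_iff.2 ⟨hlim, Eventually.of_forall fun k => (hV (φ k)).1⟩)) h1
      fun k => hVR (φ k)
  exact (iInf₂_le W hfeas).trans (EReal.coe_le_coe_iff.2 hI)

end converse

end AlgRealism

end

/-! ### The coding theorem -/

theorem theorem1 {X : Type*} [Fintype X] [Primcodable X] (hX : 2 ≤ Fintype.card X)
    (p : X → ℝ) (hp : p ∈ stdSimplex ℝ X) (hpos : ∀ x, 0 < p x)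
    (hcomp : AlgRealism.ComputableReal p)
    (d : X → X → ℝ) (hd : ∀ x y, 0 ≤ d x y)
    (B : ℕ → ℕ) (hB : ∀ n, 1 ≤ n → 1 ≤ B n)
    (hBlim : Tendsto (fun n : ℕ => Real.logb 2 (B n) / (n : ℝ)) atTop (𝓝 0))
    (Δ : ℝ) (hΔ : 0 < Δ)
    (hR : AlgRealism.rdp p d Δ < (AlgRealism.entropy p : EReal)) :
    AlgRealism.optRate p d B Δ = AlgRealism.optDetRate p d B Δ ∧
      AlgRealism.optDetRate p d B Δ = AlgRealism.rdp p d Δ := by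
  have h1 : AlgRealism.rdp p d Δ ≤ AlgRealism.optRate p d B Δ := by
    refine le_sInf ?_
    rintro _ ⟨R, ⟨hR0, Rc, hRc, h⟩, rfl⟩
    exact AlgRealism.rdp_le_of_achievable hp hpos hB hR0 hRc h
  have h2 : AlgRealism.optRate p d B Δ ≤ AlgRealism.optDetRate p d B Δ := by
    refine sInf_le_sInf (Set.image_mono ?_)
    rintro R ⟨hR0, h⟩
    refine ⟨hR0, 0, le_rfl, fun ε hε => ?_⟩
    obtain ⟨c, -, hc⟩ := h ε hε
    exact ⟨c, hc⟩
  have h3 : AlgRealism.optDetRate p d B Δ ≤ AlgRealism.rdp p d Δ := by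
    refine le_of_forall_gt fun r hr => ?_
    -- The minimum with the entropy ensures that the chosen channel has mutual information below
    -- `H(X)`, as the coding theorem needs.
    obtain ⟨W, hW⟩ := iInf_lt_iff.1 (lt_min hr hR)
    obtain ⟨hWf, hWlt⟩ := iInf_lt_iff.1 hW
    refine lt_of_le_of_lt (sInf_le ⟨AlgRealism.mutualInfo p W,
      ⟨AlgRealism.mutualInfo_nonneg hp hWf.1, ?_⟩, rfl⟩) (hWlt.trans_le (min_le_left _ _))
    exact AlgRealism.detAchievable_mutualInfo hp hpos hd hB hBlim hWf
      (EReal.coe_lt_coe_iff.1 (hWlt.trans_le (min_le_right _ _)))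
  exact ⟨le_antisymm h2 (h3.trans h1), le_antisymm h3 (h1.trans h2)⟩
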